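/- **Conventions.** Composition is written in diagrammatic order, and equalities between objects are strict. "Set" means element of a fixed category $Sets$ of sets; for a category $\mathcal C$ with hom-sets in $Sets$, $PreShv(\mathcal C)$ is the category of functors $\mathcal C^{op}\to Sets$ and $Y_{\mathcal C}:\mathcal C\to PreShv(\mathcal C)$ is the Yoneda embedding. A *C-system* is a category $CC$ with a length function $l:Ob(CC)\to\mathbb N$, an object $pt$, a map $ft:Ob(CC)\to Ob(CC)$, morphisms $p_X:X\to ft(X)$, for $l(X)>0$ and $f:Y\to ft(X)$ an object $f^*X$ and a morphism $q(f,X):f^*X\to X$, and for $l(X)>0$ and $f:Y\to X$ a morphism $s_f:Y\to (f p_X)^*X$, such that: $l^{-1}(0)=\{pt\}$; $l(ft(X))=l(X)-1$ if $l(X)>0$; $ft(pt)=pt$; $pt$ is final; $l(f^*X)>0$, $ft(f^*X)=Y$ and $q(f,X)\,p_X=p_{f^*X}\,f$; $id^*X=X$ and $q(id,X)=id_X$; $(gf)^*X=g^*(f^*X)$ and $q(gf,X)=q(g,f^*X)\,q(f,X)$; $s_f\,p_{(fp_X)^*X}=id_Y$; $s_f\,q(fp_X,X)=f$; and $s_f=s_{f\,q(g,U)}$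 if $X=g^*U$. A *homomorphism* of C-systems is a functor strictly preserving $l,pt,ft,p,f^*,q,s$. A *universe* in a category $\mathcal E$ is a morphism $p:\widetilde U\to U$ with a chosen pullback square $(X;F)\to\widetilde U$, $(X;F)\to X$ for every $F:X\to U$. Given also a chosen final object $pt$, the C-system $CC(\mathcal E,p)$ has as objects of length $n$ the elements of $Ob_n$, where $Ob_0=\{*\}$, $int(*)=pt$, $Ob_{n+1}=\{(A,F)\mid A\in Ob_n,\ F:int(A)\to U\}$ and $int(A,F)=(int(A);F)$. Its morphisms are $Hom(A,B)=Hom_{\mathcal E}(int(A),int(B))$, which makes $int:CC(\mathcal E,p)\to\mathcal E$ a fully faithful functor. Moreover $ft(A,F)=A$, $p_{(A,F)}$ is the projection $(int(A);F)\to int(A)$, $f^*(A,F)=(B,fF)$ for $f:B\to A$, and $q$ and $s$ are induced by the chosen pullbacks. **Theorem.** Let $CC$ be a C-system whose objects form a set (up to bijection), $\mathcal C$ a category with hom-sets in $Sets$, and $M:CC\to\mathcal C$ a functor that is injective on morphisms and such that $M(pt)$ is a final object of $\mathcal C$. Let $CC'$ be the subcategory of $\mathcal C$ with objects $\{M(x)\}$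 and morphisms $\{M(f)\}$, with the C-system structure carried over from $CC$ along the isomorphism $CC\cong CC'$ induced by $M$, and let $i:CC'\hookrightarrow\mathcal C$ be the inclusion. Assume that for every object $c$ of $\mathcal C$ the (small) category $i^{op}/c$ is filtered. Here $i^{op}/c$ is the slice category of $i^{op}:CC'^{op}\to\mathcal C^{op}$ over $c$, the index category of the colimit that computes left Kan extensions of presheaves along $i$ at $c$: its objects are the pairs $(x,f)$ with $x\in CC'$ and $f:i(x)\to c$ a morphism of $\mathcal C^{op}$ (that is, $f:c\to i(x)$ in $\mathcal C$), and its morphisms are the morphisms of $CC'^{op}$ over $c$. Let $Ob_1$ and $\widetilde{Ob}_1$ be the presheaves on $CC'$ given by $$Ob_1(X)=\{Y\mid l(Y)=l(X)+1,\ ft(Y)=X\},\qquad \widetilde{Ob}_1(X)=\{s:X\to Y\mid l(Y)>0,\ ft(Y)=X,\ s\,p_Y=id_X\},$$ on which $f:X'\to X$ acts by $Y\mapsto f^*Y$ and $s\mapsto s_{fs}$, and let $\partial:\widetilde{Ob}_1\to Ob_1$ be $\partial(s)=cod(s)$. Let $Lan_i:PreShv(CC')\to PreShv(\mathcal C)$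 be the left Kan extension functor. Then there exists a universe $p_M:\widetilde U_M\to U_M$ in $PreShv(\mathcal C)$, namely $p_M=Lan_i\,\partial$ with the pointwise pullbacks $(X;F)(c)=\{(x,t)\mid F_c(x)=(p_M)_c(t)\}$ (and $PreShv(\mathcal C)$ having as chosen final object the constant one-point presheaf), and a homomorphism of C-systems $M':CC\to CC(PreShv(\mathcal C),p_M)$ such that the functors $int\circ M'$ and $Y_{\mathcal C}\circ M$ from $CC$ to $PreShv(\mathcal C)$ are naturally isomorphic. -/

import Mathlib

open CategoryTheory CategoryTheory.Limits Opposite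

universe w v v₁ v₂ u u₁ u₂

/-- A C0-system structure on a category `CC`. Equalities between objects are strict, so that
morphisms are compared along `eqToHom`. Composition is written in diagrammatic order. -/
structure C0System (CC : Type u) [Category.{v} CC] where
  /-- the length function -/
  l : CC → ℕ
  /-- the distinguished object -/
  pt : CC
  /-- the father map -/
  ft : CC → CC
  /-- the canonical projections -/
  p (X : CC) : X ⟶ ft X
  /-- the object `f^* X` -/
  pull {X Y : CC} (hX : 0 < l X) (f : Y ⟶ ft X) : CC
  /-- the morphism `q(f, X) : f^* X ⟶ X` -/
  q {X Y : CC} (hX : 0 < l X) (f : Y ⟶ ft X) : pull hX f ⟶ X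
  l_eq_zero_iff (X : CC) : l X = 0 ↔ X = pt
  l_ft (X : CC) (hX : 0 < l X) : l (ft X) = l X - 1
  ft_pt : ft pt = pt
  /-- the distinguished object is a final object -/
  isTerminalPt : IsTerminal pt
  l_pull_pos {X Y : CC} (hX : 0 < l X) (f : Y ⟶ ft X) : 0 < l (pull hX f)
  ft_pull {X Y : CC} (hX : 0 < l X) (f : Y ⟶ ft X) : ft (pull hX f) = Y
  comm {X Y : CC} (hX : 0 < l X) (f : Y ⟶ ft X) :
    q hX f ≫ p X = p (pull hX f) ≫ eqToHom (ft_pull hX f) ≫ f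
  pull_id (X : CC) (hX : 0 < l X) : pull hX (𝟙 (ft X)) = X
  q_id (X : CC) (hX : 0 < l X) : q hX (𝟙 (ft X)) = eqToHom (pull_id X hX)
  pull_comp {X Y Z : CC} (hX : 0 < l X) (g : Z ⟶ Y) (f : Y ⟶ ft X) :
    pull hX (g ≫ f) = pull (l_pull_pos hX f) (g ≫ eqToHom (ft_pull hX f).symm)
  q_comp {X Y Z : CC} (hX : 0 < l X) (g : Z ⟶ Y) (f : Y ⟶ ft X) :
    q hX (g ≫ f) = eqToHom (pull_comp hX g f) ≫
      q (l_pull_pos hX f) (g ≫ eqToHom (ft_pull hX f).symm) ≫ q hX f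

/-- A C-system structure on a category `CC`: a C0-system with an operation `f ↦ s_f`, defined for
`f : Y ⟶ X` with `0 < l X`. The morphism written `ft(f)` on paper is `f ≫ p X`. -/
structure CSystem (CC : Type u) [Category.{v} CC] extends C0System CC where
  /-- the morphism `s_f : Y ⟶ (ft(f))^* X` -/
  s {X Y : CC} (hX : 0 < l X) (f : Y ⟶ X) : Y ⟶ pull hX (f ≫ p X)
  s_p {X Y : CC} (hX : 0 < l X) (f : Y ⟶ X) :
    s hX f ≫ p (pull hX (f ≫ p X)) = eqToHom (ft_pull hX (f ≫ p X)).symm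
  s_q {X Y : CC} (hX : 0 < l X) (f : Y ⟶ X) : s hX f ≫ q hX (f ≫ p X) = f
  /-- if `X = g^* U` then `s_f = s_{f ≫ q(g, U)}` -/
  s_pull {U Z Y : CC} (hU : 0 < l U) (g : Z ⟶ ft U) (f : Y ⟶ pull hU g) :
    HEq (s (l_pull_pos hU g) f) (s hU (f ≫ q hU g))

/-- A homomorphism of C-systems: a functor that strictly preserves the whole structure. -/
structure CSystemHom {CC : Type u₁} [Category.{v₁} CC] {DD : Type u₂} [Category.{v₂} DD]
    (S : CSystem CC) (T : CSystem DD) where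
  /-- the underlying functor -/
  functor : CC ⥤ DD
  l_obj (X : CC) : T.l (functor.obj X) = S.l X
  pt_obj : functor.obj S.pt = T.pt
  ft_obj (X : CC) : functor.obj (S.ft X) = T.ft (functor.obj X)
  p_map (X : CC) : functor.map (S.p X) ≫ eqToHom (ft_obj X) = T.p (functor.obj X)
  pull_obj {X Y : CC} (hX : 0 < S.l X) (f : Y ⟶ S.ft X) :
    functor.obj (S.pull hX f) =
      T.pull (hX.trans_eq (l_obj X).symm) (functor.map f ≫ eqToHom (ft_obj X))
  q_map {X Y : CC} (hX : 0 < S.l X) (f : Y ⟶ S.ft X) :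
    functor.map (S.q hX f) = eqToHom (pull_obj hX f) ≫
      T.q (hX.trans_eq (l_obj X).symm) (functor.map f ≫ eqToHom (ft_obj X))
  s_map {X Y : CC} (hX : 0 < S.l X) (f : Y ⟶ X) :
    HEq (functor.map (S.s hX f)) (T.s (hX.trans_eq (l_obj X).symm) (functor.map f))

/-- A universe category: a category `E` with a final object `pt` and a universe `p : Ut ⟶ U`, that
is, a morphism with a choice, for every `F : X ⟶ U`, of a pullback square
`(X; F) ⟶ Ut` over `F : X ⟶ U`. -/
structure UniverseCategory (E : Type u) [Category.{v} E] where
  /-- the base of the universe -/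
  U : E
  /-- the total object of the universe -/
  Ut : E
  /-- the universe morphism -/
  p : Ut ⟶ U
  /-- the chosen final object -/
  pt : E
  isTerminalPt : IsTerminal pt
  /-- the chosen pullback `(X; F)` -/
  ext {X : E} (F : X ⟶ U) : E
  /-- the projection `(X; F) ⟶ X` -/
  proj {X : E} (F : X ⟶ U) : ext F ⟶ X
  /-- the projection `Q(F) : (X; F) ⟶ Ut` -/
  Q {X : E} (F : X ⟶ U) : ext F ⟶ Ut
  isPullback {X : E} (F : X ⟶ U) : IsPullback (Q F) (proj F) p F

namespace UniverseCategory

section Generated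

variable {E : Type u} [Category.{v} E] (𝒰 : UniverseCategory E)

/-- The sets `Ob_n` of objects of length `n` together with `int_n : Ob_n → E`: `Ob_0` is a point
with `int_0 = pt`, and `Ob_(n+1)` consists of the pairs `(A, F)` with `A ∈ Ob_n` and
`F : int_n A ⟶ U`, with `int_(n+1) (A, F) = (int_n A; F)`. -/
def tower : ℕ → Σ T : Type v, T → E
  | 0 => ⟨PUnit, fun _ => 𝒰.pt⟩
  | n + 1 => ⟨Σ A : (tower n).1, ((tower n).2 A ⟶ 𝒰.U), fun A => 𝒰.ext A.2⟩

/-- The objects of the C-system generated by a universe category. -/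
structure GenOb where
  /-- the length -/
  len : ℕ
  /-- an element of `Ob_len` -/
  ob : (𝒰.tower len).1

variable {𝒰}

/-- The object part of the functor `int`. -/
def GenOb.toE (X : 𝒰.GenOb) : E := (𝒰.tower X.len).2 X.ob

/-- A morphism `X ⟶ Y` is a morphism `int X ⟶ int Y` of `E`. -/
@[ext]
structure GenOb.Hom (X Y : 𝒰.GenOb) where
  /-- the underlying morphism of `E` -/
  hom : X.toE ⟶ Y.toE

instance : Category.{v} 𝒰.GenOb where
  Hom X Y := GenOb.Hom X Y
  id X := ⟨𝟙 X.toE⟩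
  comp f g := ⟨f.hom ≫ g.hom⟩

@[ext]
theorem GenOb.hom_ext {X Y : 𝒰.GenOb} {f g : X ⟶ Y} (h : f.hom = g.hom) : f = g :=
  GenOb.Hom.ext h

@[simp]
theorem GenOb.id_hom (X : 𝒰.GenOb) : GenOb.Hom.hom (𝟙 X) = 𝟙 X.toE := rfl

@[simp]
theorem GenOb.comp_hom {X Y Z : 𝒰.GenOb} (f : X ⟶ Y) (g : Y ⟶ Z) :
    (f ≫ g).hom = f.hom ≫ g.hom := rfl

variable (𝒰) in
/-- The functor `int`, which is fully faithful by construction. -/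
@[simps]
def int : 𝒰.GenOb ⥤ E where
  obj X := X.toE
  map f := f.hom

/-- The object of length `0`. -/
def GenOb.nil : 𝒰.GenOb := ⟨0, PUnit.unit⟩

/-- The object `(A, F)`. -/
def GenOb.cons (A : 𝒰.GenOb) (F : A.toE ⟶ 𝒰.U) : 𝒰.GenOb := ⟨A.len + 1, ⟨A.ob, F⟩⟩

/-- The father: `ft (A, F) = A`. -/
def GenOb.ft : 𝒰.GenOb → 𝒰.GenOb
  | ⟨0, A⟩ => ⟨0, A⟩
  | ⟨n + 1, A⟩ => ⟨n, A.1⟩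

/-- The morphism `F` at `X = (A, F)`. -/
def GenOb.F : (X : 𝒰.GenOb) → 0 < X.len → (X.ft.toE ⟶ 𝒰.U)
  | ⟨0, _⟩, h => absurd h (lt_irrefl 0)
  | ⟨_ + 1, A⟩, _ => A.2

/-- The canonical projection, which is `(int A; F) ⟶ int A` at `X = (A, F)`. -/
def GenOb.p : (X : 𝒰.GenOb) → (X ⟶ X.ft)
  | ⟨0, _⟩ => 𝟙 _
  | ⟨_ + 1, A⟩ => ⟨𝒰.proj A.2⟩

/-- The morphism `Q(F)` at `X = (A, F)`. -/
def GenOb.Q : (X : 𝒰.GenOb) → (h : 0 < X.len) → (X.toE ⟶ 𝒰.Ut)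
  | ⟨0, _⟩, h => absurd h (lt_irrefl 0)
  | ⟨_ + 1, A⟩, _ => 𝒰.Q A.2

theorem GenOb.isPullback : (X : 𝒰.GenOb) → (h : 0 < X.len) →
    IsPullback (X.Q h) X.p.hom 𝒰.p (X.F h)
  | ⟨0, _⟩, h => absurd h (lt_irrefl 0)
  | ⟨_ + 1, A⟩, _ => 𝒰.isPullback A.2

theorem GenOb.ext_of_pos {X Y : 𝒰.GenOb} (hX : 0 < X.len) {f g : Y ⟶ X}
    (h₁ : f.hom ≫ X.Q hX = g.hom ≫ X.Q hX) (h₂ : f ≫ X.p = g ≫ X.p) : f = g :=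
  GenOb.hom_ext ((X.isPullback hX).hom_ext h₁ (congrArg GenOb.Hom.hom h₂))

/-- The object `f^* (A, F) = (Y, f ≫ F)`. -/
def GenOb.pull {X Y : 𝒰.GenOb} (hX : 0 < X.len) (f : Y ⟶ X.ft) : 𝒰.GenOb :=
  Y.cons (f.hom ≫ X.F hX)

theorem GenOb.pull_len_pos {X Y : 𝒰.GenOb} (hX : 0 < X.len) (f : Y ⟶ X.ft) :
    0 < (pull hX f).len :=
  Nat.succ_pos _

/-- The canonical projection of `f^* X`, seen as a morphism to `Y = ft (f^* X)`. -/
def GenOb.pullFst {X Y : 𝒰.GenOb} (hX : 0 < X.len) (f : Y ⟶ X.ft) : pull hX f ⟶ Y :=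
  (pull hX f).p

/-- The morphism `Q(f ≫ F)` at `f^* X`. -/
def GenOb.pullQ {X Y : 𝒰.GenOb} (hX : 0 < X.len) (f : Y ⟶ X.ft) : (pull hX f).toE ⟶ 𝒰.Ut :=
  (pull hX f).Q (pull_len_pos hX f)

theorem GenOb.pull_isPullback {X Y : 𝒰.GenOb} (hX : 0 < X.len) (f : Y ⟶ X.ft) :
    IsPullback (pullQ hX f) (pullFst hX f).hom 𝒰.p (f.hom ≫ X.F hX) :=
  (pull hX f).isPullback (pull_len_pos hX f)

/-- The morphism `q(f, X) : f^* X ⟶ X`: it is `Q(f ≫ F)` over `Ut`, and lies over `f`. -/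
noncomputable def GenOb.q {X Y : 𝒰.GenOb} (hX : 0 < X.len) (f : Y ⟶ X.ft) : pull hX f ⟶ X :=
  ⟨(X.isPullback hX).lift (pullQ hX f) ((pullFst hX f).hom ≫ f.hom)
    (by rw [Category.assoc]; exact (pull_isPullback hX f).w)⟩

theorem GenOb.q_Q {X Y : 𝒰.GenOb} (hX : 0 < X.len) (f : Y ⟶ X.ft) :
    (q hX f).hom ≫ X.Q hX = pullQ hX f :=
  (X.isPullback hX).lift_fst _ _ _

theorem GenOb.q_p {X Y : 𝒰.GenOb} (hX : 0 < X.len) (f : Y ⟶ X.ft) :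
    q hX f ≫ X.p = pullFst hX f ≫ f :=
  GenOb.hom_ext ((X.isPullback hX).lift_snd _ _ _)

/-- The morphism `s_f : Y ⟶ (ft(f))^* X`: the section of the projection with `s_f ≫ q = f`. -/
noncomputable def GenOb.s {X Y : 𝒰.GenOb} (hX : 0 < X.len) (f : Y ⟶ X) : Y ⟶ pull hX (f ≫ X.p) :=
  ⟨(pull_isPullback hX (f ≫ X.p)).lift (f.hom ≫ X.Q hX) (𝟙 Y.toE) (by
    rw [Category.assoc, (X.isPullback hX).w, Category.id_comp, comp_hom, Category.assoc])⟩

theorem GenOb.s_Q {X Y : 𝒰.GenOb} (hX : 0 < X.len) (f : Y ⟶ X) :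
    (s hX f).hom ≫ pullQ hX (f ≫ X.p) = f.hom ≫ X.Q hX :=
  (pull_isPullback hX (f ≫ X.p)).lift_fst _ _ _

theorem GenOb.s_p {X Y : 𝒰.GenOb} (hX : 0 < X.len) (f : Y ⟶ X) :
    s hX f ≫ pullFst hX (f ≫ X.p) = 𝟙 Y :=
  GenOb.hom_ext ((pull_isPullback hX (f ≫ X.p)).lift_snd _ _ _)

theorem GenOb.s_q {X Y : 𝒰.GenOb} (hX : 0 < X.len) (f : Y ⟶ X) :
    s hX f ≫ q hX (f ≫ X.p) = f := by
  apply ext_of_pos hX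
  · rw [comp_hom, Category.assoc, q_Q, s_Q]
  · rw [Category.assoc, q_p, reassoc_of% (s_p hX f)]

theorem GenOb.eqToHom_Q {X Y : 𝒰.GenOb} (h : X = Y) (hX : 0 < X.len) (hY : 0 < Y.len) :
    (eqToHom h : X ⟶ Y).hom ≫ Y.Q hY = X.Q hX := by
  subst h
  exact Category.id_comp _

theorem GenOb.eqToHom_p {X Y : 𝒰.GenOb} (h : X = Y) :
    eqToHom h ≫ Y.p = X.p ≫ eqToHom (congrArg GenOb.ft h) := by
  subst h
  simp

theorem GenOb.pull_ext {X Y W : 𝒰.GenOb} (hX : 0 < X.len) (f : Y ⟶ X.ft) {a b : W ⟶ pull hX f}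
    (h₁ : a.hom ≫ pullQ hX f = b.hom ≫ pullQ hX f)
    (h₂ : a ≫ pullFst hX f = b ≫ pullFst hX f) : a = b :=
  ext_of_pos (pull_len_pos hX f) h₁ h₂

theorem GenOb.eqToHom_pullQ {X X' Y Y' : 𝒰.GenOb} (hX : 0 < X.len) (f : Y ⟶ X.ft)
    (hX' : 0 < X'.len) (f' : Y' ⟶ X'.ft) (h : pull hX f = pull hX' f') :
    (eqToHom h : pull hX f ⟶ pull hX' f').hom ≫ pullQ hX' f' = pullQ hX f :=
  eqToHom_Q h _ _

theorem GenOb.eqToHom_pullFst {X X' Y : 𝒰.GenOb} (hX : 0 < X.len) (f : Y ⟶ X.ft)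
    (hX' : 0 < X'.len) (f' : Y ⟶ X'.ft) (h : pull hX f = pull hX' f') :
    eqToHom h ≫ pullFst hX' f' = pullFst hX f :=
  (eqToHom_p h).trans (Category.comp_id _)

theorem GenOb.pull_id (X : 𝒰.GenOb) (hX : 0 < X.len) : pull hX (𝟙 X.ft) = X := by
  have h : pull hX (𝟙 X.ft) = cons X.ft (X.F hX) :=
    congrArg (cons X.ft) (Category.id_comp _)
  rw [h]
  obtain ⟨n, A⟩ := X
  cases n with
  | zero => exact absurd hX (lt_irrefl 0)
  | succ n => rfl

theorem GenOb.q_id (X : 𝒰.GenOb) (hX : 0 < X.len) :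
    q hX (𝟙 X.ft) = eqToHom (pull_id X hX) := by
  apply ext_of_pos hX
  · rw [q_Q, eqToHom_Q _ (pull_len_pos hX _)]
    rfl
  · rw [q_p, eqToHom_p, Category.comp_id]
    exact (Category.comp_id _).symm

theorem GenOb.pull_comp {X Y Z : 𝒰.GenOb} (hX : 0 < X.len) (g : Z ⟶ Y) (f : Y ⟶ X.ft)
    (g' : Z ⟶ (pull hX f).ft) (hg : g' = g) :
    pull hX (g ≫ f) = pull (pull_len_pos hX f) g' := by
  subst hg
  exact congrArg (cons Z) (Category.assoc _ _ _)

theorem GenOb.q_comp {X Y Z : 𝒰.GenOb} (hX : 0 < X.len) (g : Z ⟶ Y) (f : Y ⟶ X.ft)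
    (g' : Z ⟶ (pull hX f).ft) (hg : g' = g) :
    q hX (g ≫ f) = eqToHom (pull_comp hX g f g' hg) ≫ q (pull_len_pos hX f) g' ≫ q hX f := by
  apply ext_of_pos hX
  · rw [comp_hom, comp_hom, Category.assoc, Category.assoc, q_Q, q_Q]
    refine Eq.trans ?_ (congrArg _ (q_Q (pull_len_pos hX f) g').symm)
    rw [eqToHom_pullQ]
  · rw [Category.assoc, Category.assoc, q_p, q_p]
    have h : q (pull_len_pos hX f) g' ≫ pullFst hX f = pullFst (pull_len_pos hX f) g' ≫ g := by
      subst hg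
      exact q_p (pull_len_pos hX f) g'
    rw [reassoc_of% h, ← Category.assoc, ← Category.assoc, eqToHom_pullFst, Category.assoc]

theorem GenOb.s_pull {U Z Y : 𝒰.GenOb} (hU : 0 < U.len) (g : Z ⟶ U.ft) (f : Y ⟶ pull hU g) :
    HEq (s (pull_len_pos hU g) f) (s hU (f ≫ q hU g)) := by
  have h : pull (pull_len_pos hU g) (f ≫ (pull hU g).p) = pull hU ((f ≫ q hU g) ≫ U.p) := by
    rw [Category.assoc, q_p, ← Category.assoc]
    exact (pull_comp hU _ g _ rfl).symm
  have h' : s (pull_len_pos hU g) f ≫ eqToHom h = s hU (f ≫ q hU g) := by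
    apply pull_ext
    · rw [comp_hom, Category.assoc, eqToHom_pullQ, s_Q, s_Q, comp_hom, Category.assoc, q_Q]
      rfl
    · rw [Category.assoc, eqToHom_pullFst, s_p, s_p]
  rw [← h']
  exact (comp_eqToHom_heq _ _).symm

variable (𝒰) in
/-- The C-system generated by a universe category. -/
noncomputable def cSystem : CSystem 𝒰.GenOb where
  l := GenOb.len
  pt := GenOb.nil
  ft := GenOb.ft
  p := GenOb.p
  pull := GenOb.pull
  q := GenOb.q
  l_eq_zero_iff
    | ⟨0, _⟩ => ⟨fun _ => rfl, fun _ => rfl⟩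
    | ⟨n + 1, _⟩ => ⟨fun h => absurd h (Nat.succ_ne_zero n), fun h => congrArg GenOb.len h⟩
  l_ft
    | ⟨0, _⟩, h => absurd h (lt_irrefl 0)
    | ⟨_ + 1, _⟩, _ => rfl
  ft_pt := rfl
  isTerminalPt := IsTerminal.ofUniqueHom (fun X => ⟨𝒰.isTerminalPt.from X.toE⟩)
    (fun _ _ => GenOb.hom_ext (𝒰.isTerminalPt.hom_ext _ _))
  l_pull_pos := GenOb.pull_len_pos
  ft_pull _ _ := rfl
  comm hX f := (GenOb.q_p hX f).trans (congrArg _ (Category.id_comp f).symm)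
  pull_id := GenOb.pull_id
  q_id := GenOb.q_id
  pull_comp hX g f := GenOb.pull_comp hX g f _ (Category.comp_id g)
  q_comp hX g f := GenOb.q_comp hX g f _ (Category.comp_id g)
  s := GenOb.s
  s_p := GenOb.s_p
  s_q := GenOb.s_q
  s_pull := GenOb.s_pull

end Generated
end UniverseCategory
namespace C0System

variable {CC : Type u} [Category.{v} CC] (S : C0System CC)

theorem l_pull {X Y : CC} (hX : 0 < S.l X) (f : Y ⟶ S.ft X) :
    S.l (S.pull hX f) = S.l Y + 1 := by
  have h := S.l_ft (S.pull hX f) (S.l_pull_pos hX f)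
  rw [S.ft_pull] at h
  have := S.l_pull_pos hX f
  omega

theorem pull_congr {X X' Y Y' : CC} (hX : 0 < S.l X) (hX' : 0 < S.l X') (hx : X = X')
    (hy : Y = Y') (f : Y ⟶ S.ft X) (f' : Y' ⟶ S.ft X')
    (hf : f = eqToHom hy ≫ f' ≫ eqToHom (congrArg S.ft hx.symm)) :
    S.pull hX f = S.pull hX' f' := by
  subst hx hy
  simp [hf]

theorem q_congr {X X' Y Y' : CC} (hX : 0 < S.l X) (hX' : 0 < S.l X') (hx : X = X')
    (hy : Y = Y') (f : Y ⟶ S.ft X) (f' : Y' ⟶ S.ft X')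
    (hf : f = eqToHom hy ≫ f' ≫ eqToHom (congrArg S.ft hx.symm)) :
    S.q hX f = eqToHom (S.pull_congr hX hX' hx hy f f' hf) ≫ S.q hX' f' ≫ eqToHom hx.symm := by
  subst hx hy
  obtain rfl : f = f' := by simpa using hf
  simp

theorem p_congr {X Y : CC} (h : X = Y) :
    S.p X = eqToHom h ≫ S.p Y ≫ eqToHom (congrArg S.ft h.symm) := by
  subst h
  simp

end C0System

namespace CSystem

variable {CC : Type u} [Category.{v} CC] (S : CSystem CC)

/-- Morphisms into `f^* X` are determined by their composites with the two projections. -/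
theorem pull_hom_ext {X Y W : CC} (hX : 0 < S.l X) (f : Y ⟶ S.ft X) {a b : W ⟶ S.pull hX f}
    (h₁ : a ≫ S.q hX f = b ≫ S.q hX f)
    (h₂ : a ≫ S.p (S.pull hX f) = b ≫ S.p (S.pull hX f)) : a = b := by
  have key : ∀ (r r' : W ⟶ S.ft (S.pull hX f)) (u : W ⟶ S.pull (S.l_pull_pos hX f) r)
      (u' : W ⟶ S.pull (S.l_pull_pos hX f) r'), r = r' → HEq u u' →
      u ≫ S.q _ r = u' ≫ S.q _ r' := by
    rintro r r' u u' rfl hu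
    rw [eq_of_heq hu]
  rw [← S.s_q (S.l_pull_pos hX f) a, ← S.s_q (S.l_pull_pos hX f) b]
  refine key _ _ _ _ h₂ ((S.s_pull hX f a).trans (HEq.trans ?_ (S.s_pull hX f b).symm))
  rw [h₁]

/-- The set `Ob_1(X)` of the objects `Y` with `l(Y) = l(X) + 1` and `ft(Y) = X`. -/
def Ob₁ (X : CC) : Type u := {Y : CC // S.l Y = S.l X + 1 ∧ S.ft Y = X}

/-- The set of the sections `s : ft(Y) ⟶ Y` of canonical projections with `l(Y) > 0` and
`ft(Y) = X`. -/
@[ext]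
structure Obt₁ (X : CC) where
  /-- the codomain of the section -/
  cod : CC
  l_pos : 0 < S.l cod
  ft_cod : S.ft cod = X
  /-- the section -/
  sec : X ⟶ cod
  sec_p : sec ≫ S.p cod = eqToHom ft_cod.symm

variable {S}

/-- The action `Y ↦ f^* Y` on `Ob_1`. -/
def Ob₁.map {X X' : CC} (f : X' ⟶ X) (Y : S.Ob₁ X) : S.Ob₁ X' :=
  ⟨S.pull (X := Y.1) (by have := Y.2.1; omega) (f ≫ eqToHom Y.2.2.symm),
    S.l_pull _ _, S.ft_pull _ _⟩

/-- The pulled back section `f^*(s, 1) = s_{f ≫ s} : X' ⟶ f^* Y`. -/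
def Obt₁.mapSec {X X' : CC} (f : X' ⟶ X) (t : S.Obt₁ X) :
    X' ⟶ S.pull t.l_pos (f ≫ eqToHom t.ft_cod.symm) :=
  S.s t.l_pos (f ≫ t.sec) ≫ eqToHom (by rw [Category.assoc, t.sec_p])

theorem Obt₁.mapSec_q {X X' : CC} (f : X' ⟶ X) (t : S.Obt₁ X) :
    t.mapSec f ≫ S.q t.l_pos (f ≫ eqToHom t.ft_cod.symm) = f ≫ t.sec := by
  conv_rhs => rw [← S.s_q t.l_pos (f ≫ t.sec)]
  rw [S.q_congr t.l_pos t.l_pos rfl rfl ((f ≫ t.sec) ≫ S.p t.cod) (f ≫ eqToHom t.ft_cod.symm)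
    (by simp [t.sec_p])]
  simp [Obt₁.mapSec]

/-- The action `s ↦ f^*(s, 1)` on `Obt_1`. -/
def Obt₁.map {X X' : CC} (f : X' ⟶ X) (t : S.Obt₁ X) : S.Obt₁ X' where
  cod := S.pull t.l_pos (f ≫ eqToHom t.ft_cod.symm)
  l_pos := S.l_pull_pos _ _
  ft_cod := S.ft_pull _ _
  sec := t.mapSec f
  sec_p := by
    have h : S.pull t.l_pos ((f ≫ t.sec) ≫ S.p t.cod) =
      S.pull t.l_pos (f ≫ eqToHom t.ft_cod.symm) := by rw [Category.assoc, t.sec_p]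
    rw [S.p_congr h.symm]
    simp [Obt₁.mapSec, reassoc_of% (S.s_p t.l_pos (f ≫ t.sec))]

theorem Obt₁.ext_of_q {W U : CC} (hU : 0 < S.l U) {r r' : W ⟶ S.ft U} (hr : r = r')
    {t t' : S.Obt₁ W} (e : t.cod = S.pull hU r) (e' : t'.cod = S.pull hU r')
    {k : t.cod ⟶ U} (hk : k = eqToHom e ≫ S.q hU r) {k' : t'.cod ⟶ U}
    (hk' : k' = eqToHom e' ≫ S.q hU r') (h : t.sec ≫ k = t'.sec ≫ k') : t = t' := by
  subst hk hk'
  subst hr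
  obtain ⟨Y, _, _, a, ha⟩ := t
  obtain ⟨Y', _, _, a', ha'⟩ := t'
  dsimp only at e e' h
  subst e
  subst e'
  obtain rfl : a = a' := by
    refine S.pull_hom_ext hU r ?_ (ha.trans ha'.symm)
    simpa using h
  rfl

theorem Ob₁.map_id {X : CC} (Y : S.Ob₁ X) : Y.map (𝟙 X) = Y := by
  obtain ⟨Y, hY, rfl⟩ := Y
  apply Subtype.ext
  simpa [Ob₁.map] using S.pull_id Y (by omega)

theorem Ob₁.map_comp {X X' X'' : CC} (f : X' ⟶ X) (g : X'' ⟶ X') (Y : S.Ob₁ X) :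
    Y.map (g ≫ f) = (Y.map f).map g := by
  obtain ⟨Y, hY, rfl⟩ := Y
  apply Subtype.ext
  have hl : 0 < S.l Y := by omega
  have hr : f ≫ eqToHom rfl = f := by simp
  refine Eq.trans ?_ (S.pull_comp hl g (f ≫ eqToHom rfl))
  exact S.pull_congr hl hl rfl rfl _ _ (by simp)

theorem Obt₁.map_id {X : CC} (t : S.Obt₁ X) : t.map (𝟙 X) = t := by
  have h := t.mapSec_q (𝟙 X)
  obtain ⟨Y, hY, rfl, s, hs⟩ := t
  refine Obt₁.ext_of_q hY (r := 𝟙 (S.ft Y) ≫ eqToHom rfl) (r' := 𝟙 (S.ft Y)) (by simp) rfl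
    (S.pull_id Y hY).symm (Category.id_comp _).symm (k' := 𝟙 Y) ?_ ?_
  · rw [S.q_id Y hY, eqToHom_trans, eqToHom_refl]
  · exact h.trans ((Category.id_comp _).trans (Category.comp_id _).symm)

theorem Obt₁.map_comp {X X' X'' : CC} (f : X' ⟶ X) (g : X'' ⟶ X') (t : S.Obt₁ X) :
    t.map (g ≫ f) = (t.map f).map g := by
  have h₁ := t.mapSec_q f
  have h₂ := (t.map f).mapSec_q g
  have h₃ := t.mapSec_q (g ≫ f)
  refine Obt₁.ext_of_q t.l_pos (r := (g ≫ f) ≫ eqToHom t.ft_cod.symm)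
    (r' := g ≫ f ≫ eqToHom t.ft_cod.symm) (by simp) rfl
    (S.pull_comp t.l_pos g (f ≫ eqToHom t.ft_cod.symm)).symm (Category.id_comp _).symm
    (k' := S.q (t.map f).l_pos (g ≫ eqToHom (t.map f).ft_cod.symm) ≫
      S.q t.l_pos (f ≫ eqToHom t.ft_cod.symm)) ?_ ?_
  · have h := S.q_comp t.l_pos g (f ≫ eqToHom t.ft_cod.symm)
    have h' : ∀ {A B C : CC} (e : A = B) (a : A ⟶ C) (b : B ⟶ C), a = eqToHom e ≫ b →
        b = eqToHom e.symm ≫ a := by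
      rintro A B C rfl a b h
      simpa using h.symm
    exact h' _ _ _ h
  · have h₄ := congrArg (fun a => a ≫ S.q t.l_pos (f ≫ eqToHom t.ft_cod.symm)) h₂
    refine (h₃.trans ?_).trans (h₄.symm.trans (Category.assoc _ _ _))
    exact (Category.assoc _ _ _).trans ((congrArg (g ≫ ·) h₁.symm).trans
      (Category.assoc _ _ _).symm)

variable (S)

/-- The presheaf `Ob_1`, before its values are replaced by isomorphic sets of the universe in which
presheaves take their values. -/
def Ob₁Large : CCᵒᵖ ⥤ Type u where
  obj X := S.Ob₁ X.unop
  map f := ↾(fun Y => Ob₁.map f.unop Y)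
  map_id X := ConcreteCategory.hom_ext (C := Type u) _ _ (fun Y => Ob₁.map_id (X := X.unop) Y)
  map_comp f g := ConcreteCategory.hom_ext _ _ (fun Y => Ob₁.map_comp f.unop g.unop Y)

/-- The presheaf of sections `Obt_1`, before its values are replaced by isomorphic sets. -/
def Obt₁Large : CCᵒᵖ ⥤ Type (max u v) where
  obj X := S.Obt₁ X.unop
  map f := ↾(fun t => Obt₁.map f.unop t)
  map_id X := 
    ConcreteCategory.hom_ext (C := Type (max u v)) _ _ (fun t => Obt₁.map_id (X := X.unop) t)
  map_comp f g := ConcreteCategory.hom_ext _ _ (fun t => Obt₁.map_comp f.unop g.unop t)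

variable {S}

/-- The map `∂ : Obt_1(X) → Ob_1(X)`, `∂(s) = cod(s)`. -/
def Obt₁.boundary {X : CC} (t : S.Obt₁ X) : S.Ob₁ X :=
  ⟨t.cod, by
    have h := S.l_ft t.cod t.l_pos
    rw [t.ft_cod] at h
    have := t.l_pos
    omega, t.ft_cod⟩

variable (S)

instance small_Ob₁ [Small.{w} CC] (X : CC) : Small.{w} (S.Ob₁ X) :=
  inferInstanceAs (Small.{w} {Y : CC // S.l Y = S.l X + 1 ∧ S.ft Y = X})

instance small_Obt₁ [Small.{w} CC] [LocallySmall.{w} CC] (X : CC) : Small.{w} (S.Obt₁ X) :=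
  small_of_injective (β := Σ Y : CC, X ⟶ Y) (f := fun t => ⟨t.cod, t.sec⟩) (by
    rintro ⟨Y, _, _, a, _⟩ ⟨Y', _, _, a', _⟩ h
    obtain ⟨rfl, h⟩ := Sigma.mk.inj_iff.1 h
    obtain rfl := eq_of_heq h
    rfl)

instance [Small.{w} CC] : FunctorToTypes.Small.{w} S.Ob₁Large :=
  fun X => small_Ob₁.{w} S X.unop

instance [Small.{w} CC] [LocallySmall.{w} CC] : FunctorToTypes.Small.{w} S.Obt₁Large :=
  fun X => small_Obt₁.{w} S X.unop

/-- The presheaf of sets `Ob_1` on `CC`. -/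
noncomputable def Ob₁Presheaf [Small.{w} CC] : CCᵒᵖ ⥤ Type w :=
  FunctorToTypes.shrink.{w} S.Ob₁Large

/-- The presheaf of sets `Obt_1` on `CC`. -/
noncomputable def Obt₁Presheaf [Small.{w} CC] [LocallySmall.{w} CC] : CCᵒᵖ ⥤ Type w :=
  FunctorToTypes.shrink.{w} S.Obt₁Large

/-- The natural transformation `∂ : Obt_1 ⟶ Ob_1`. -/
noncomputable def boundary [Small.{w} CC] [LocallySmall.{w} CC] :
    Obt₁Presheaf.{w} S ⟶ Ob₁Presheaf.{w} S where
  app X := ↾(fun t : Shrink.{w} (S.Obt₁ X.unop) =>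
    equivShrink.{w} (S.Ob₁ X.unop) ((equivShrink (S.Obt₁ X.unop)).symm t).boundary)
  naturality X Y f := by
    refine ConcreteCategory.hom_ext _ _ (fun t => ?_)
    change equivShrink (S.Ob₁ Y.unop) ((equivShrink (S.Obt₁ Y.unop)).symm
        (equivShrink (S.Obt₁ Y.unop)
          (Obt₁.map f.unop ((equivShrink (S.Obt₁ X.unop)).symm t)))).boundary =
      equivShrink (S.Ob₁ Y.unop) (Ob₁.map f.unop ((equivShrink (S.Ob₁ X.unop)).symm
        (equivShrink (S.Ob₁ X.unop) ((equivShrink (S.Obt₁ X.unop)).symm t).boundary)))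
    rw [Equiv.symm_apply_apply, Equiv.symm_apply_apply]
    rfl

end CSystem

/-- The universe category of presheaves on `C` given by a morphism of presheaves `p : Ut ⟶ U`,
with the canonical pointwise pullbacks `(X; F)(c) = {(x, t) | F(x) = p(t)}` and the final presheaf
that is constant at a point. -/
def presheafUniverse {C : Type u} [Category.{v} C] {U Ut : Cᵒᵖ ⥤ Type w} (p : Ut ⟶ U) :
    UniverseCategory (Cᵒᵖ ⥤ Type w) where
  U := U
  Ut := Ut
  p := p
  pt := (Functor.const Cᵒᵖ).obj PUnit
  isTerminalPt := IsTerminal.ofUniqueHom (fun X => { app := fun _ => ↾(fun _ => PUnit.unit) })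
    (fun X m => by ext; rfl)
  ext {X} F :=
    { obj := fun c => {z : X.obj c × Ut.obj c // F.app c z.1 = p.app c z.2}
      map := fun {c d} f => ↾(fun z => ⟨(X.map f z.1.1, Ut.map f z.1.2), by
        rw [NatTrans.naturality_apply, NatTrans.naturality_apply, z.2]⟩)
      map_id := fun c => ConcreteCategory.hom_ext _ _ (fun z => Subtype.ext (by simp))
      map_comp := fun f g => ConcreteCategory.hom_ext _ _ (fun z => Subtype.ext (by simp)) }
  proj F := { app := fun c => ↾(fun z => z.1.1) }
  Q F := { app := fun c => ↾(fun z => z.1.2) }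
  isPullback {X} F := by
    refine ⟨⟨?_⟩, ⟨PullbackCone.IsLimit.mk _ (fun s =>
      { app := fun c => ↾(fun y => ⟨(s.snd.app c y, s.fst.app c y), ?_⟩)
        naturality := ?_ }) ?_ ?_ ?_⟩⟩
    · ext c z
      exact z.2.symm
    · exact (ConcreteCategory.congr_hom (NatTrans.congr_app s.condition c) y).symm
    · intro c d f
      refine ConcreteCategory.hom_ext _ _ (fun y => Subtype.ext (Prod.ext ?_ ?_))
      · exact NatTrans.naturality_apply s.snd f y
      · exact NatTrans.naturality_apply s.fst f y
    · intro s
      rfl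
    · intro s
      rfl
    · intro s m h₁ h₂
      refine NatTrans.ext (funext fun c => ConcreteCategory.hom_ext _ _ fun y => ?_)
      refine Subtype.ext (Prod.ext ?_ ?_)
      · exact ConcreteCategory.congr_hom (NatTrans.congr_app h₂ c) y
      · exact ConcreteCategory.congr_hom (NatTrans.congr_app h₁ c) y
section Image

variable {CC : Type u₁} [Category.{v₁} CC] {C : Type u} [Category.{v} C]

/-- A functor that is injective on morphisms: equality of `M f` and `M g`, including their domains
and codomains, implies equality of `f` and `g`, including their domains and codomains. -/
def InjectiveOnMorphisms (M : CC ⥤ C) : Prop :=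
  Function.Injective M.mapArrow.obj

theorem InjectiveOnMorphisms.obj_inj {M : CC ⥤ C} (hM : InjectiveOnMorphisms M) {x y : CC}
    (h : M.obj x = M.obj y) : x = y := by
  have h₁ : ∀ {a b : C}, a = b → Arrow.mk (𝟙 a) = Arrow.mk (𝟙 b) := by
    rintro a _ rfl
    rfl
  have h₂ : ∀ z, M.mapArrow.obj (Arrow.mk (𝟙 z)) = Arrow.mk (𝟙 (M.obj z)) :=
    fun z => congrArg Arrow.mk (M.map_id z)
  have : M.mapArrow.obj (Arrow.mk (𝟙 x)) = M.mapArrow.obj (Arrow.mk (𝟙 y)) := by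
    rw [h₂, h₂, h₁ h]
  exact congrArg Arrow.left (hM this)

theorem InjectiveOnMorphisms.map_inj {M : CC ⥤ C} (hM : InjectiveOnMorphisms M) {x y : CC}
    {f g : x ⟶ y} (h : M.map f = M.map g) : f = g :=
  Arrow.mk_injective x y (hM (congrArg Arrow.mk h))

/-- The set of objects `{M(x) | x ∈ Ob(CC)}` of the image of `M`. -/
structure ImageCat (M : CC ⥤ C) (hM : InjectiveOnMorphisms M) where
  /-- the object of `C` -/
  obj : C
  mem : obj ∈ Set.range M.obj

namespace ImageCat

variable {M : CC ⥤ C} {hM : InjectiveOnMorphisms M}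

/-- The morphisms of the image of `M` are the elements of `{M(f) | f ∈ Mor(CC)}`. -/
@[ext]
structure Hom (c d : ImageCat M hM) where
  /-- the morphism of `C` -/
  hom : c.obj ⟶ d.obj
  mem : Arrow.mk hom ∈ Set.range M.mapArrow.obj

theorem exists_map {x y : CC} {g : M.obj x ⟶ M.obj y} (hM : InjectiveOnMorphisms M)
    (h : Arrow.mk g ∈ Set.range M.mapArrow.obj) : ∃ f : x ⟶ y, M.map f = g := by
  obtain ⟨a, ha⟩ := h
  obtain ⟨x', y', f⟩ := a
  have h₁ : M.obj x' = M.obj x := congrArg Arrow.left ha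
  have h₂ : M.obj y' = M.obj y := congrArg Arrow.right ha
  obtain rfl := hM.obj_inj h₁
  obtain rfl := hM.obj_inj h₂
  refine ⟨f, ?_⟩
  exact Arrow.mk_injective _ _ ha

/-- The image of `M` as a subcategory of `C`. -/
instance : Category.{v} (ImageCat M hM) where
  Hom c d := Hom c d
  id c := ⟨𝟙 c.obj, by
    obtain ⟨_, x, rfl⟩ := c
    exact ⟨Arrow.mk (𝟙 x), congrArg Arrow.mk (M.map_id x)⟩⟩
  comp {c d e} f g := ⟨f.hom ≫ g.hom, by
    obtain ⟨_, x, rfl⟩ := c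
    obtain ⟨_, y, rfl⟩ := d
    obtain ⟨_, z, rfl⟩ := e
    obtain ⟨f', hf⟩ := exists_map hM f.mem
    obtain ⟨g', hg⟩ := exists_map hM g.mem
    exact ⟨Arrow.mk (f' ≫ g'), congrArg Arrow.mk ((M.map_comp f' g').trans (by rw [hf, hg]))⟩⟩
  id_comp f := Hom.ext (Category.id_comp f.hom)
  comp_id f := Hom.ext (Category.comp_id f.hom)
  assoc f g h := Hom.ext (Category.assoc f.hom g.hom h.hom)

@[ext]
theorem hom_ext {c d : ImageCat M hM} {f g : c ⟶ d} (h : f.hom = g.hom) : f = g :=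
  Hom.ext h

variable (M hM)

/-- The inclusion functor `i` of the image of `M`. -/
@[simps]
def incl : ImageCat M hM ⥤ C where
  obj c := c.obj
  map f := f.hom

/-- The restriction of `M` onto its image. -/
@[simps]
def restr : CC ⥤ ImageCat M hM where
  obj x := ⟨M.obj x, x, rfl⟩
  map f := ⟨M.map f, Arrow.mk f, rfl⟩
  map_id x := hom_ext (M.map_id x)
  map_comp f g := hom_ext (M.map_comp f g)

theorem restr_comp_incl : restr M hM ⋙ incl M hM = M := rfl

instance : (restr M hM).Faithful where
  map_injective h := hM.map_inj (congrArg Hom.hom h)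

instance : (restr M hM).Full where
  map_surjective g := by
    obtain ⟨f, hf⟩ := exists_map hM g.mem
    exact ⟨f, hom_ext hf⟩

theorem restr_bijective : Function.Bijective (restr M hM).obj :=
  ⟨fun _ _ h => hM.obj_inj (congrArg ImageCat.obj h), fun ⟨_, x, h⟩ => ⟨x, by subst h; rfl⟩⟩

instance [Small.{w} CC] : Small.{w} (ImageCat M hM) :=
  small_of_surjective (restr_bijective M hM).2

instance [Small.{v} CC] (P : (ImageCat M hM)ᵒᵖ ⥤ Type v) :
    (incl M hM).op.HasLeftKanExtension P := by
  infer_instance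

end ImageCat
end Image


namespace CSystem

section Transport

variable {CC : Type u₁} [Category.{v₁} CC] {D : Type u} [Category.{v} D]

section Inverse

variable (N : CC ⥤ D) (hN : Function.Bijective N.obj)

/-- The object part of the inverse of an isomorphism of categories `N`. -/
noncomputable def invObj (c : D) : CC := (hN.2 c).choose

theorem obj_invObj (c : D) : N.obj (invObj N hN c) = c := (hN.2 c).choose_spec

theorem invObj_obj (x : CC) : invObj N hN (N.obj x) = x := hN.1 (obj_invObj N hN (N.obj x))

variable [N.Full] [N.Faithful]

/-- The inverse of an isomorphism of categories `N`. -/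
noncomputable def inv : D ⥤ CC where
  obj c := invObj N hN c
  map g := N.preimage (eqToHom (obj_invObj N hN _) ≫ g ≫ eqToHom (obj_invObj N hN _).symm)
  map_id c := N.map_injective (by simp)
  map_comp f g := N.map_injective (by simp)

theorem obj_inv (c : D) : N.obj ((inv N hN).obj c) = c := obj_invObj N hN c

theorem inv_obj (x : CC) : (inv N hN).obj (N.obj x) = x := invObj_obj N hN x

theorem map_inv {c d : D} (g : c ⟶ d) : N.map ((inv N hN).map g) =
    eqToHom (obj_inv N hN c) ≫ g ≫ eqToHom (obj_inv N hN d).symm := by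
  simp [inv]

theorem inv_map {x y : CC} (f : x ⟶ y) : (inv N hN).map (N.map f) =
    eqToHom (inv_obj N hN x) ≫ f ≫ eqToHom (inv_obj N hN y).symm :=
  N.map_injective (by simp [map_inv, eqToHom_map])

theorem inv_map_injective {c d : D} {f g : c ⟶ d} (h : (inv N hN).map f = (inv N hN).map g) :
    f = g := by
  have h' := congrArg N.map h
  rw [map_inv, map_inv] at h'
  exact (cancel_mono _).1 ((cancel_epi _).1 h')

theorem inv_obj_injective {c d : D} (h : (inv N hN).obj c = (inv N hN).obj d) : c = d := by
  rw [← obj_inv N hN c, h, obj_inv]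

end Inverse

theorem s_heq (S : CSystem CC) {X X' Y Y' : CC} (hX : 0 < S.l X) (hX' : 0 < S.l X') (hx : X = X')
    (hy : Y = Y') (f : Y ⟶ X) (f' : Y' ⟶ X') (hf : f = eqToHom hy ≫ f' ≫ eqToHom hx.symm) :
    HEq (S.s hX f) (S.s hX' f') := by
  subst hx hy
  obtain rfl : f = f' := by simpa using hf
  rfl

theorem heq_map (N : CC ⥤ D) {x y x' y' : CC} (hx : x = x') (hy : y = y') {f : x ⟶ y}
    {f' : x' ⟶ y'} (h : HEq f f') : HEq (N.map f) (N.map f') := by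
  subst hx hy
  rw [eq_of_heq h]

/-- The transport of a C-system structure along an isomorphism of categories `N`, given by
`l(N(x)) = l(x)`, `ft(N(x)) = N(ft(x))`, `p_{N(x)} = N(p_x)`, `N(f)^*(N(x)) = N(f^* x)`,
`q(N(f), N(x)) = N(q(f, x))` and `s_{N(f)} = N(s_f)`. -/
noncomputable def transport (S : CSystem CC) (N : CC ⥤ D) [N.Full] [N.Faithful]
    (hN : Function.Bijective N.obj) : CSystem D where
  l c := S.l ((inv N hN).obj c)
  pt := N.obj S.pt
  ft c := N.obj (S.ft ((inv N hN).obj c))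
  p c := eqToHom (obj_inv N hN c).symm ≫ N.map (S.p ((inv N hN).obj c))
  pull {X Y} hX f := N.obj (S.pull hX ((inv N hN).map f ≫ eqToHom (inv_obj N hN _)))
  q {X Y} hX f := N.map (S.q hX ((inv N hN).map f ≫ eqToHom (inv_obj N hN _))) ≫
    eqToHom (obj_inv N hN X)
  l_eq_zero_iff X := by
    rw [S.l_eq_zero_iff]
    constructor
    · intro h
      rw [← h, obj_inv]
    · rintro rfl
      exact inv_obj N hN _
  l_ft X hX := by rw [inv_obj, S.l_ft _ hX]
  ft_pt := by rw [inv_obj, S.ft_pt]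
  isTerminalPt := IsTerminal.ofUniqueHom
    (fun c => eqToHom (obj_inv N hN c).symm ≫ N.map (S.isTerminalPt.from _))
    (fun c m => inv_map_injective N hN (by
      rw [← cancel_mono (eqToHom (inv_obj N hN S.pt))]
      exact S.isTerminalPt.hom_ext _ _))
  l_pull_pos {X Y} hX f := by
    rw [inv_obj]
    exact S.l_pull_pos _ _
  ft_pull {X Y} hX f := by
    rw [inv_obj, S.ft_pull, obj_inv]
  comm {X Y} hX f := inv_map_injective N hN (by
    simp only [Functor.map_comp, eqToHom_map, inv_map, Category.assoc,
      eqToHom_trans_assoc, eqToHom_refl, Category.id_comp]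
    rw [S.p_congr (inv_obj N hN (S.pull hX ((inv N hN).map f ≫ eqToHom (inv_obj N hN _))))]
    simp [reassoc_of% (S.comm hX ((inv N hN).map f ≫ eqToHom (inv_obj N hN _)))])
  pull_id X hX := by
    apply inv_obj_injective N hN
    rw [inv_obj]
    refine Eq.trans ?_ (S.pull_id _ hX)
    exact S.pull_congr hX hX rfl (inv_obj N hN _) _ _ (by simp)
  q_id X hX := inv_map_injective N hN (by
    have h := S.q_congr hX hX rfl (inv_obj N hN _)
      ((inv N hN).map (𝟙 (N.obj (S.ft ((inv N hN).obj X)))) ≫ eqToHom (inv_obj N hN _))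
      (𝟙 _) (by simp)
    rw [h, S.q_id]
    simp [eqToHom_map])
  pull_comp {X Y Z} hX g f := by
    apply inv_obj_injective N hN
    refine (inv_obj N hN _).trans (Eq.trans ?_ (inv_obj N hN _).symm)
    have hf := S.pull_comp hX ((inv N hN).map g) ((inv N hN).map f ≫ eqToHom (inv_obj N hN _))
    refine Eq.trans ?_ (hf.trans ?_)
    · exact S.pull_congr hX hX rfl rfl _ _ (by simp)
    · exact S.pull_congr _ _ (inv_obj N hN _).symm rfl _ _ (by simp [eqToHom_map])
  q_comp {X Y Z} hX g f := inv_map_injective N hN (by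
    have hf := S.q_comp hX ((inv N hN).map g) ((inv N hN).map f ≫ eqToHom (inv_obj N hN _))
    have h₁ := S.q_congr hX hX rfl rfl
      ((inv N hN).map (g ≫ f) ≫ eqToHom (inv_obj N hN _))
      ((inv N hN).map g ≫ (inv N hN).map f ≫ eqToHom (inv_obj N hN _)) (by simp)
    have h₂ := S.q_congr (by rw [inv_obj]; exact S.l_pull_pos _ _) (S.l_pull_pos hX _)
      (inv_obj N hN (S.pull hX ((inv N hN).map f ≫ eqToHom (inv_obj N hN _)))) rfl
      ((inv N hN).map (g ≫ eqToHom (by rw [inv_obj, S.ft_pull, obj_inv])) ≫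
        eqToHom (inv_obj N hN _))
      ((inv N hN).map g ≫ eqToHom (S.ft_pull hX _).symm) (by simp [eqToHom_map])
    rw [h₁, hf, h₂]
    simp [inv_map, eqToHom_map])
  s {X Y} hX f := eqToHom (obj_inv N hN Y).symm ≫ N.map (S.s hX ((inv N hN).map f)) ≫
    eqToHom (congrArg N.obj (S.pull_congr hX hX rfl rfl _ _ (by simp [inv_map, eqToHom_map])))
  s_p {X Y} hX f := inv_map_injective N hN (by
    have h := S.s_p hX ((inv N hN).map f)
    have h₁ : S.pull hX ((inv N hN).map (f ≫ eqToHom (obj_inv N hN X).symm ≫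
        N.map (S.p ((inv N hN).obj X))) ≫ eqToHom (inv_obj N hN _)) =
        S.pull hX ((inv N hN).map f ≫ S.p ((inv N hN).obj X)) :=
      S.pull_congr hX hX rfl rfl _ _ (by simp [inv_map, eqToHom_map])
    have h₂ := S.p_congr ((inv_obj N hN (S.pull hX ((inv N hN).map (f ≫
      eqToHom (obj_inv N hN X).symm ≫ N.map (S.p ((inv N hN).obj X))) ≫
      eqToHom (inv_obj N hN _)))).trans h₁)
    rw [h₂]
    simp [inv_map, eqToHom_map, reassoc_of% h])
  s_q {X Y} hX f := inv_map_injective N hN (by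
    have h := S.s_q hX ((inv N hN).map f)
    have h₁ := S.q_congr hX hX rfl rfl ((inv N hN).map (f ≫ eqToHom (obj_inv N hN X).symm ≫
        N.map (S.p ((inv N hN).obj X))) ≫ eqToHom (inv_obj N hN _))
        ((inv N hN).map f ≫ S.p ((inv N hN).obj X)) (by simp [inv_map, eqToHom_map])
    rw [h₁]
    simp [inv_map, eqToHom_map, h])
  s_pull {U Z Y} hU g f := by
    have h₁ := S.s_pull hU ((inv N hN).map g ≫ eqToHom (inv_obj N hN _))
      ((inv N hN).map f ≫ eqToHom (inv_obj N hN _))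
    have hp : 0 < S.l ((inv N hN).obj
        (N.obj (S.pull hU ((inv N hN).map g ≫ eqToHom (inv_obj N hN _))))) := by
      rw [inv_obj]
      exact S.l_pull_pos _ _
    have h₂ := S.s_heq hp (S.l_pull_pos hU ((inv N hN).map g ≫ eqToHom (inv_obj N hN _)))
      (inv_obj N hN _) rfl ((inv N hN).map f)
      ((inv N hN).map f ≫ eqToHom (inv_obj N hN _)) (by simp)
    have h₃ := S.s_heq hU hU rfl rfl
      (((inv N hN).map f ≫ eqToHom (inv_obj N hN _)) ≫
        S.q hU ((inv N hN).map g ≫ eqToHom (inv_obj N hN _)))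
      ((inv N hN).map (f ≫ N.map (S.q hU ((inv N hN).map g ≫ eqToHom (inv_obj N hN _))) ≫
        eqToHom (obj_inv N hN U))) (by simp [inv_map, eqToHom_map])
    rw [eqToHom_comp_heq_iff, heq_eqToHom_comp_iff, comp_eqToHom_heq_iff, heq_comp_eqToHom_iff]
    have e₁ := S.pull_congr hp (S.l_pull_pos hU ((inv N hN).map g ≫ eqToHom (inv_obj N hN _)))
      (inv_obj N hN _) rfl ((inv N hN).map f ≫ S.p _)
      (((inv N hN).map f ≫ eqToHom (inv_obj N hN _)) ≫ S.p _) (by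
        rw [S.p_congr (inv_obj N hN _)]
        simp)
    have e₂ : S.pull (S.l_pull_pos hU ((inv N hN).map g ≫ eqToHom (inv_obj N hN _)))
        (((inv N hN).map f ≫ eqToHom (inv_obj N hN _)) ≫ S.p _) =
        S.pull hU (((inv N hN).map (f ≫ N.map (S.q hU ((inv N hN).map g ≫
          eqToHom (inv_obj N hN _))) ≫ eqToHom (obj_inv N hN U))) ≫ S.p _) := by
      have hc := S.comm hU ((inv N hN).map g ≫ eqToHom (inv_obj N hN _))
      have hd := S.pull_comp hU (((inv N hN).map f ≫ eqToHom (inv_obj N hN _)) ≫ S.p _ ≫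
        eqToHom (S.ft_pull hU ((inv N hN).map g ≫ eqToHom (inv_obj N hN _))))
        ((inv N hN).map g ≫ eqToHom (inv_obj N hN _))
      refine Eq.trans ?_ (hd.symm.trans ?_)
      · exact S.pull_congr _ _ rfl rfl _ _ (by simp)
      · exact S.pull_congr _ _ rfl rfl _ _ (by simp [inv_map, eqToHom_map, hc])
    exact heq_map N rfl (e₁.trans e₂) (h₂.trans (h₁.trans h₃))

/-- The isomorphism of categories `N` is a homomorphism to the transported C-system. -/
noncomputable def transportHom (S : CSystem CC) (N : CC ⥤ D) [N.Full] [N.Faithful]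
    (hN : Function.Bijective N.obj) : CSystemHom S (S.transport N hN) where
  functor := N
  l_obj X := congrArg S.l (inv_obj N hN X)
  pt_obj := rfl
  ft_obj X := congrArg (fun x => N.obj (S.ft x)) (inv_obj N hN X).symm
  p_map X := by
    have h := S.p_congr (inv_obj N hN X)
    simp only [transport]
    rw [h]
    simp [eqToHom_map]
  pull_obj {X Y} hX f := by
    have e : N.obj (S.ft X) = N.obj (S.ft ((inv N hN).obj (N.obj X))) := by rw [inv_obj]
    have h := S.pull_congr hX (hX.trans_eq (congrArg S.l (inv_obj N hN X)).symm)
      (inv_obj N hN X).symm (inv_obj N hN Y).symm f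
      ((inv N hN).map (N.map f ≫ eqToHom e) ≫ eqToHom (inv_obj N hN _))
      (by simp [inv_map, eqToHom_map])
    exact congrArg N.obj h
  q_map {X Y} hX f := by
    have e : N.obj (S.ft X) = N.obj (S.ft ((inv N hN).obj (N.obj X))) := by rw [inv_obj]
    have h := S.q_congr hX (hX.trans_eq (congrArg S.l (inv_obj N hN X)).symm)
      (inv_obj N hN X).symm (inv_obj N hN Y).symm f
      ((inv N hN).map (N.map f ≫ eqToHom e) ≫ eqToHom (inv_obj N hN _))
      (by simp [inv_map, eqToHom_map])
    rw [h]
    simp [transport, eqToHom_map]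
  s_map {X Y} hX f := by
    have h := S.s_heq hX (hX.trans_eq (congrArg S.l (inv_obj N hN X)).symm)
      (inv_obj N hN X).symm (inv_obj N hN Y).symm f ((inv N hN).map (N.map f))
      (by simp [inv_map])
    dsimp only [transport]
    rw [heq_eqToHom_comp_iff, heq_comp_eqToHom_iff]
    refine heq_map N (inv_obj N hN Y).symm ?_ h
    refine S.pull_congr _ _ (inv_obj N hN X).symm (inv_obj N hN Y).symm _ _ ?_
    rw [S.p_congr (inv_obj N hN X)]
    simp [inv_map]

end Transport

/-- The C-system on the image of a functor that is injective on morphisms. -/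
noncomputable def image {CC : Type u₁} [Category.{v₁} CC] {C : Type u} [Category.{v} C]
    (S : CSystem CC) (M : CC ⥤ C) (hM : InjectiveOnMorphisms M) : CSystem (ImageCat M hM) :=
  S.transport (ImageCat.restr M hM) (ImageCat.restr_bijective M hM)

/-- The restriction of `M` onto its image is a homomorphism of C-systems. -/
noncomputable def imageHom {CC : Type u₁} [Category.{v₁} CC] {C : Type u} [Category.{v} C]
    (S : CSystem CC) (M : CC ⥤ C) (hM : InjectiveOnMorphisms M) : CSystemHom S (S.image M hM) :=
  S.transportHom (ImageCat.restr M hM) (ImageCat.restr_bijective M hM)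

end CSystem

/-- The morphism of presheaves `p_M = Lan_i ∂`, where `i : CC' ⥤ C` is the inclusion of the image
C-system of `M` and `Lan_i` is the left Kan extension of presheaves along `i`, that is, the left
Kan extension of functors on `CC'ᵒᵖ` along `i.op`. -/
noncomputable def lanBoundary {CC : Type u₁} [Category.{v₁} CC] [Small.{v} CC] (S : CSystem CC)
    {C : Type u} [Category.{v} C] (M : CC ⥤ C) (hM : InjectiveOnMorphisms M) :
    (ImageCat.incl M hM).op.lan.obj (CSystem.Obt₁Presheaf.{v} (S.image M hM)) ⟶
      (ImageCat.incl M hM).op.lan.obj (CSystem.Ob₁Presheaf.{v} (S.image M hM)) :=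
  (ImageCat.incl M hM).op.lan.map (CSystem.boundary.{v} (S.image M hM))

universe v₃ u₃

/-! Let `X` have positive length in a C-system. A morphism `m : Z ⟶ X` is the same as a morphism `a
: Z ⟶ ft X` together with a section `t` of the projection of `a^*X`: from `m` one gets `a = m ≫ p_X`
and the pullback along `m` of the diagonal section `s_{id_X}`, and from `(a, t)` one recovers `m = t
≫ q(a, X)`. Hence the diagonal of `X`, as a map from the presheaf represented by `X` to `Obt₁`, and
`X` itself, as a map from the presheaf represented by `ft X` to `Ob₁`, form a pullback square over
`∂` (`diag_boundary`, `diag_map_injective`, `exists_diag_map_eq`).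

The left Kan extension along the inclusion `i` takes representables to representables, and at `c` it
is a colimit over `i^op/c`. As this category is filtered, the extension preserves pullbacks, so the
projection `Y(i X) ⟶ Y(i (ft X))` is a pullback of `Lan_i ∂`. In `lan_isPullback` this is checked on
representatives: an element at `c` is a class of pairs of a morphism `c ⟶ i x` and a value at `x`,
and equal classes agree after passing to a common stage.

The rest is formal and holds for any functor `G` into a universe category with such squares
(`UniverseModel`). By induction on the length, `X` is sent to the pair of the image of `ft X` and
the classifying morphism of `X`, with a comparison isomorphism to `G(X)` because both are pullbacks
of the same cospan. Strictness costs nothing: pulling back in the generated C-system is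
precomposition of classifying morphisms, so naturality of these morphisms gives an equality of
objects. The morphisms `q` and `s` are then forced by the universal property of the pullbacks.
Precomposing with the isomorphism from `CC` to its image finishes the proof. -/

theorem UniverseCategory.GenOb.eqToHom_comp_pullFst {E : Type u} [Category.{v} E]
    {𝒰 : UniverseCategory E} {W X Y : 𝒰.GenOb} (hX : 0 < X.len) (f : Y ⟶ X.ft)
    (h : W = pull hX f) (h' : W.ft = Y) :
    eqToHom h ≫ pullFst hX f = W.p ≫ eqToHom h' := by
  subst h
  exact (Category.id_comp _).trans (Category.comp_id (pullFst hX f)).symm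

/-! ### Homomorphisms to a generated C-system from pullback squares -/

namespace CSystem

/-- A functor `G : CC ⥤ E` together with pullback squares that exhibit the projections `G(p_X)` as
pullbacks of the universe morphism, compatibly with the operations `f^* X` and `q(f, X)`. -/
structure UniverseModel {CC : Type u₁} [Category.{v₁} CC] (S : CSystem CC) {E : Type u}
    [Category.{v} E] (𝒰 : UniverseCategory E) (G : CC ⥤ E) where
  /-- the classifying morphism of `X` -/
  F (X : CC) (hX : 0 < S.l X) : G.obj (S.ft X) ⟶ 𝒰.U
  /-- the morphism to the total object over the classifying morphism of `X` -/
  Q (X : CC) (hX : 0 < S.l X) : G.obj X ⟶ 𝒰.Ut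
  isPullback (X : CC) (hX : 0 < S.l X) : IsPullback (Q X hX) (G.map (S.p X)) 𝒰.p (F X hX)
  F_pull {X Y : CC} (hX : 0 < S.l X) (f : Y ⟶ S.ft X) :
    F (S.pull hX f) (S.l_pull_pos hX f) = G.map (eqToHom (S.ft_pull hX f) ≫ f) ≫ F X hX
  Q_pull {X Y : CC} (hX : 0 < S.l X) (f : Y ⟶ S.ft X) :
    Q (S.pull hX f) (S.l_pull_pos hX f) = G.map (S.q hX f) ≫ Q X hX
  /-- the distinguished object goes to a final object -/
  isTerminalPt : IsTerminal (G.obj S.pt)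

namespace UniverseModel

open UniverseCategory

variable {CC : Type u₁} [Category.{v₁} CC] {S : CSystem CC} {E : Type u}
    [Category.{v} E] {𝒰 : UniverseCategory E} {G : CC ⥤ E} (R : S.UniverseModel 𝒰 G)

theorem cons_isPullback {X : CC} (hX : 0 < S.l X) {A : 𝒰.GenOb}
    (e : A.toE ≅ G.obj (S.ft X)) :
    IsPullback (𝒰.Q (e.hom ≫ R.F X hX)) (𝒰.proj (e.hom ≫ R.F X hX) ≫ e.hom) 𝒰.p (R.F X hX) :=
  (𝒰.isPullback (e.hom ≫ R.F X hX)).of_iso (Iso.refl _) (Iso.refl _) e (Iso.refl _)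
    (by simp) (by simp) (by simp) (by simp)

/-- The object of the generated C-system that corresponds to an object of length `n`, with the
comparison isomorphism. -/
noncomputable def objAux : (n : ℕ) → (X : CC) → S.l X = n →
    Σ A : 𝒰.GenOb, A.toE ≅ G.obj X
  | 0, X, h => ⟨GenOb.nil, 𝒰.isTerminalPt.uniqueUpToIso
      (R.isTerminalPt.ofIso (eqToIso (congrArg G.obj ((S.l_eq_zero_iff X).1 h).symm)))⟩
  | n + 1, X, h =>
    have hX : 0 < S.l X := h ▸ n.succ_pos
    have r := objAux n (S.ft X) ((S.l_ft X hX).trans (by omega))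
    -- The classifying morphism starts at `G(ft X)`, so it is moved to `int` of the object already
    -- built. Both resulting squares are pullbacks of `p` along `F X`, which gives the new
    -- comparison isomorphism.
    ⟨r.1.cons (r.2.hom ≫ R.F X hX),
      (R.cons_isPullback hX r.2).isoIsPullback _ _ (R.isPullback X hX)⟩

/-- The object of the generated C-system that corresponds to `X`. -/
noncomputable def obj (X : CC) : 𝒰.GenOb := (R.objAux _ X rfl).1

/-- The comparison isomorphism between `int` of the object that corresponds to `X` and `G(X)`. -/
noncomputable def iso (X : CC) : (R.obj X).toE ≅ G.obj X := (R.objAux _ X rfl).2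

theorem objAux_eq {n : ℕ} {X : CC} (h : S.l X = n) : R.objAux n X h = ⟨R.obj X, R.iso X⟩ := by
  subst h
  rfl

/-- The recursion runs on a numeral equal to the length; this unfolds it from positivity alone.
Object and isomorphism stay in one pair because the type of the second depends on the first. -/
theorem objAux_of_pos {X : CC} (hX : 0 < S.l X) {n : ℕ} (h : S.l X = n) : R.objAux n X h =
    ⟨(R.obj (S.ft X)).cons ((R.iso (S.ft X)).hom ≫ R.F X hX),
      (R.cons_isPullback hX (R.iso (S.ft X))).isoIsPullback _ _ (R.isPullback X hX)⟩ := by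
  cases n with
  | zero => omega
  | succ n =>
    have := S.l_ft X hX
    have h' := R.objAux_eq (n := n) (X := S.ft X) (by omega)
    unfold objAux
    dsimp only
    rw [h']

theorem obj_of_pos {X : CC} (hX : 0 < S.l X) :
    R.obj X = (R.obj (S.ft X)).cons ((R.iso (S.ft X)).hom ≫ R.F X hX) :=
  congrArg Sigma.fst (R.objAux_of_pos hX rfl)

theorem obj_pt : R.obj S.pt = GenOb.nil := by
  have h : S.l S.pt = 0 := (S.l_eq_zero_iff _).2 rfl
  have h' := R.objAux_eq h
  exact (congrArg Sigma.fst h').symm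

theorem len_obj (X : CC) : (R.obj X).len = S.l X := by
  induction h : S.l X generalizing X with
  | zero =>
    rw [(S.l_eq_zero_iff X).1 h, obj_pt]
    rfl
  | succ n ih =>
    have hX : 0 < S.l X := by omega
    have := S.l_ft X hX
    rw [R.obj_of_pos hX]
    exact congrArg (· + 1) (ih (S.ft X) (by omega))

theorem len_pos {X : CC} (hX : 0 < S.l X) : 0 < (R.obj X).len := hX.trans_eq (R.len_obj X).symm

theorem obj_ft (X : CC) : R.obj (S.ft X) = (R.obj X).ft := by
  rcases Nat.eq_zero_or_pos (S.l X) with h | h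
  · rw [(S.l_eq_zero_iff X).1 h, S.ft_pt, obj_pt]
    rfl
  · rw [R.obj_of_pos h]
    rfl

/-- The morphism of the generated C-system that corresponds to `f`. -/
noncomputable def map {X Y : CC} (f : X ⟶ Y) : R.obj X ⟶ R.obj Y :=
  ⟨(R.iso X).hom ≫ G.map f ≫ (R.iso Y).inv⟩

theorem map_hom_iso {X Y : CC} (f : X ⟶ Y) :
    (R.map f).hom ≫ (R.iso Y).hom = (R.iso X).hom ≫ G.map f := by
  simp [map]

theorem map_id (X : CC) : R.map (𝟙 X) = 𝟙 (R.obj X) := GenOb.hom_ext (by simp [map])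

theorem map_comp {X Y Z : CC} (f : X ⟶ Y) (g : Y ⟶ Z) :
    R.map (f ≫ g) = R.map f ≫ R.map g := GenOb.hom_ext (by simp [map])

theorem map_eqToHom {X Y : CC} (h : X = Y) :
    R.map (eqToHom h) = eqToHom (congrArg R.obj h) := by
  subst h
  exact R.map_id X

/-- The functor to the generated C-system that corresponds to a model. -/
noncomputable def functor : CC ⥤ 𝒰.GenOb where
  obj := R.obj
  map := R.map
  map_id := R.map_id
  map_comp := R.map_comp

/-- The functor of a model lifts `G` along `int`. -/
noncomputable def functorCompInt : R.functor ⋙ 𝒰.int ≅ G :=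
  NatIso.ofComponents R.iso R.map_hom_iso

/-- These are the defining equations of the comparison isomorphism as an isomorphism of pullbacks,
together with the classifying morphism of the image of `X`. -/
theorem exists_eqToHom_hom_of_pos {X : CC} (hX : 0 < S.l X) :
    ((R.iso X).hom ≫ R.Q X hX = (R.obj X).Q (R.len_pos hX)) ∧
    ((R.iso X).hom ≫ G.map (S.p X) = ((R.obj X).p ≫ eqToHom (R.obj_ft X).symm).hom ≫
      (R.iso (S.ft X)).hom) ∧
    (R.obj X).F (R.len_pos hX) = (eqToHom (R.obj_ft X).symm : _ ⟶ R.obj (S.ft X)).hom ≫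
      (R.iso (S.ft X)).hom ≫ R.F X hX := by
  -- The pair is generalized to a variable so that substitution replaces object and isomorphism at
  -- once; afterwards the equations hold by construction.
  have key : ∀ (r : Σ A : 𝒰.GenOb, A.toE ≅ G.obj X), r =
      ⟨(R.obj (S.ft X)).cons ((R.iso (S.ft X)).hom ≫ R.F X hX),
        (R.cons_isPullback hX (R.iso (S.ft X))).isoIsPullback _ _ (R.isPullback X hX)⟩ →
      ∀ (h : 0 < r.1.len) (h' : r.1.ft = R.obj (S.ft X)),
      r.2.hom ≫ R.Q X hX = r.1.Q h ∧
      r.2.hom ≫ G.map (S.p X) = (r.1.p ≫ eqToHom h').hom ≫ (R.iso (S.ft X)).hom ∧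
      r.1.F h = (eqToHom h').hom ≫ (R.iso (S.ft X)).hom ≫ R.F X hX := by
    rintro _ rfl h h'
    refine ⟨IsPullback.isoIsPullback_hom_fst _ _ _ _, ?_, ?_⟩
    · refine (IsPullback.isoIsPullback_hom_snd _ _ _ _).trans ?_
      exact congrArg (· ≫ (R.iso (S.ft X)).hom) (Category.comp_id _).symm
    · exact (Category.id_comp _).symm
  exact key _ (R.objAux_of_pos hX rfl) _ _

theorem iso_Q {X : CC} (hX : 0 < S.l X) :
    (R.iso X).hom ≫ R.Q X hX = (R.obj X).Q (R.len_pos hX) :=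
  (R.exists_eqToHom_hom_of_pos hX).1

theorem F_obj {X : CC} (hX : 0 < S.l X) :
    (R.obj X).F (R.len_pos hX) = (eqToHom (R.obj_ft X).symm : _ ⟶ R.obj (S.ft X)).hom ≫
      (R.iso (S.ft X)).hom ≫ R.F X hX :=
  (R.exists_eqToHom_hom_of_pos hX).2.2

theorem map_Q {X Y : CC} (hX : 0 < S.l X) (f : Y ⟶ X) :
    (R.map f).hom ≫ (R.obj X).Q (R.len_pos hX) = (R.iso Y).hom ≫ G.map f ≫ R.Q X hX := by
  rw [← R.iso_Q hX, reassoc_of% (R.map_hom_iso f)]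

theorem map_p (X : CC) :
    R.map (S.p X) ≫ eqToHom (R.obj_ft X) = (R.obj X).p := by
  rcases Nat.eq_zero_or_pos (S.l X) with h | h
  · have hft : GenOb.nil = (R.obj X).ft := by
      rw [(S.l_eq_zero_iff X).1 h, obj_pt]
      rfl
    exact ((𝒰.cSystem.isTerminalPt).ofIso (eqToIso hft)).hom_ext _ _
  · rw [← cancel_mono (eqToHom (R.obj_ft X).symm)]
    apply GenOb.hom_ext
    rw [← cancel_mono (R.iso (S.ft X)).hom, ← (R.exists_eqToHom_hom_of_pos h).2.1,
      ← R.map_hom_iso, Category.assoc, eqToHom_trans, eqToHom_refl, Category.comp_id]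

/-- Both sides are pairs over the image of `Y`, so only classifying morphisms have to agree, and
that is `F_pull` combined with the naturality of the comparison isomorphism. -/
theorem obj_pull {X Y : CC} (hX : 0 < S.l X) (f : Y ⟶ S.ft X) :
    R.obj (S.pull hX f) =
      GenOb.pull (R.len_pos hX) (R.map f ≫ eqToHom (R.obj_ft X)) := by
  rw [R.obj_of_pos (S.l_pull_pos hX f), GenOb.pull, R.F_obj hX, F_pull]
  -- The father of `f^*X` is only propositionally `Y`; this absorbs the transport between them.
  have key : ∀ {Z : CC} (h : Z = Y) (g : G.obj Y ⟶ 𝒰.U),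
      (R.obj Z).cons ((R.iso Z).hom ≫ G.map (eqToHom h) ≫ g) =
        (R.obj Y).cons ((R.iso Y).hom ≫ g) := by
    rintro _ rfl g
    simp
  rw [G.map_comp, Category.assoc, key]
  congr 1
  have : (eqToHom (R.obj_ft X)).hom ≫ (eqToHom (R.obj_ft X).symm).hom = 𝟙 _ := by
    rw [← GenOb.comp_hom, eqToHom_trans, eqToHom_refl, GenOb.id_hom]
  rw [GenOb.comp_hom, Category.assoc, reassoc_of% this, reassoc_of% (R.map_hom_iso f)]

/-- Morphisms into a pullback are compared on its two legs: `Q_pull` settles the one to the total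
object, `comm` the projection. -/
theorem map_q {X Y : CC} (hX : 0 < S.l X) (f : Y ⟶ S.ft X) :
    R.map (S.q hX f) = eqToHom (R.obj_pull hX f) ≫
      GenOb.q (R.len_pos hX) (R.map f ≫ eqToHom (R.obj_ft X)) := by
  apply GenOb.ext_of_pos (R.len_pos hX)
  · rw [GenOb.comp_hom, Category.assoc, GenOb.q_Q, R.map_Q hX, ← R.Q_pull, R.iso_Q]
    exact (GenOb.eqToHom_Q _ _ _).symm
  · rw [Category.assoc, GenOb.q_p, ← R.map_p, ← reassoc_of% R.map_comp, S.comm]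
    rw [reassoc_of% (GenOb.eqToHom_comp_pullFst _ _ (R.obj_pull hX f)
      ((R.obj_ft _).symm.trans (congrArg R.obj (S.ft_pull hX f)))), ← R.map_p]
    simp [map_comp, map_eqToHom]

/-- A model carries no data for `s`, because `s_f` is the unique section whose composite with `q` is
`f`. The codomains agree only through `obj_pull`, so the two sections are compared after a
transport. -/
theorem map_s {X Y : CC} (hX : 0 < S.l X) (f : Y ⟶ X) :
    HEq (R.map (S.s hX f)) (GenOb.s (R.len_pos hX) (R.map f)) := by
  have h : GenOb.pull (R.len_pos hX) (R.map f ≫ (R.obj X).p) =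
      R.obj (S.pull hX (f ≫ S.p X)) := by
    rw [R.obj_pull, R.map_comp, Category.assoc, R.map_p]
  have h' : R.map (S.s hX f) = GenOb.s (R.len_pos hX) (R.map f) ≫ eqToHom h := by
    rw [← cancel_mono (eqToHom h.symm), Category.assoc, eqToHom_trans, eqToHom_refl,
      Category.comp_id]
    apply GenOb.pull_ext
    · rw [GenOb.s_Q, GenOb.comp_hom, Category.assoc, GenOb.pullQ,
        GenOb.eqToHom_Q h.symm (R.len_pos (S.l_pull_pos hX _)),
        R.map_Q (S.l_pull_pos hX (f ≫ S.p X)), R.map_Q hX, R.Q_pull, ← G.map_comp_assoc, S.s_q]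
    · rw [GenOb.s_p, Category.assoc, GenOb.eqToHom_comp_pullFst _ _ h.symm
        ((R.obj_ft _).symm.trans (congrArg R.obj (S.ft_pull hX _))),
        ← R.map_p (S.pull hX (f ≫ S.p X)), Category.assoc, ← reassoc_of% R.map_comp, S.s_p]
      simp [map_eqToHom]
  rw [h']
  exact comp_eqToHom_heq _ _

/-- The homomorphism of C-systems that corresponds to a model. -/
noncomputable def hom : CSystemHom S 𝒰.cSystem where
  functor := R.functor
  l_obj := R.len_obj
  pt_obj := R.obj_pt
  ft_obj := R.obj_ft
  p_map := R.map_p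
  pull_obj := R.obj_pull
  q_map := R.map_q
  s_map := R.map_s

end UniverseModel

end CSystem

/-! ### Composition of homomorphisms -/

/-- The composition of homomorphisms of C-systems. -/
def CSystemHom.comp {C₁ : Type u₁} [Category.{v₁} C₁] {C₂ : Type u₂} [Category.{v₂} C₂]
    {C₃ : Type u₃} [Category.{v₃} C₃] {S₁ : CSystem C₁} {S₂ : CSystem C₂} {S₃ : CSystem C₃}
    (H : CSystemHom S₁ S₂) (K : CSystemHom S₂ S₃) : CSystemHom S₁ S₃ where
  functor := H.functor ⋙ K.functor
  l_obj X := (K.l_obj _).trans (H.l_obj X)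
  pt_obj := (congrArg K.functor.obj H.pt_obj).trans K.pt_obj
  ft_obj X := (congrArg K.functor.obj (H.ft_obj X)).trans (K.ft_obj _)
  p_map X := by
    refine Eq.trans ?_ (K.p_map (H.functor.obj X))
    rw [← H.p_map]
    simp [eqToHom_map]
  pull_obj {X Y} hX f := by
    have h := K.pull_obj (hX.trans_eq (H.l_obj X).symm) (H.functor.map f ≫ eqToHom (H.ft_obj X))
    refine (congrArg K.functor.obj (H.pull_obj hX f)).trans (h.trans ?_)
    exact S₃.pull_congr _ _ rfl rfl _ _ (by simp [eqToHom_map])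
  q_map {X Y} hX f := by
    have h := K.q_map (hX.trans_eq (H.l_obj X).symm) (H.functor.map f ≫ eqToHom (H.ft_obj X))
    rw [Functor.comp_map, H.q_map, Functor.map_comp, h, S₃.q_congr _
      (hX.trans_eq ((K.l_obj _).trans (H.l_obj X)).symm) rfl rfl _
      ((H.functor ⋙ K.functor).map f ≫
        eqToHom ((congrArg K.functor.obj (H.ft_obj X)).trans (K.ft_obj _)))
      (by simp [eqToHom_map])]
    simp [eqToHom_map]
  s_map {X Y} hX f := by
    refine (CSystem.heq_map K.functor rfl ?_ (H.s_map hX f)).trans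
      (K.s_map (hX.trans_eq (H.l_obj X).symm) (H.functor.map f))
    rw [H.pull_obj]
    refine S₂.pull_congr _ _ rfl rfl _ _ ?_
    rw [← H.p_map]
    simp

/-! ### Diagonal sections and the pullback square over `∂` inside a C-system -/

namespace CSystem

section Diagonal

variable {D : Type u} [Category.{v} D] (S : CSystem D)

/-- The object `X`, seen as an element of `Ob_1(ft(X))`. -/
def toOb₁ (X : D) (hX : 0 < S.l X) : S.Ob₁ (S.ft X) :=
  ⟨X, by have := S.l_ft X hX; omega, rfl⟩

/-- The diagonal section `s_{id_X}` of the projection of `p_X^* X`. -/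
def diag (X : D) (hX : 0 < S.l X) : S.Obt₁ X where
  cod := S.pull hX (𝟙 X ≫ S.p X)
  l_pos := S.l_pull_pos _ _
  ft_cod := S.ft_pull _ _
  sec := S.s hX (𝟙 X)
  sec_p := S.s_p hX (𝟙 X)

variable {S}

theorem toOb₁_map_val {X Y : D} (hX : 0 < S.l X) (f : Y ⟶ S.ft X) :
    ((S.toOb₁ X hX).map f).1 = S.pull hX f :=
  S.pull_congr hX hX rfl rfl _ _ (by rw [eqToHom_refl, Category.id_comp]; rfl)

/-- The source of `F_pull`: the element of `Ob₁` that classifies `f^*X` is the restriction of the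
one that classifies `X`. -/
theorem toOb₁_pull {X Y : D} (hX : 0 < S.l X) (f : Y ⟶ S.ft X) :
    S.toOb₁ (S.pull hX f) (S.l_pull_pos hX f) =
      (S.toOb₁ X hX).map (eqToHom (S.ft_pull hX f) ≫ f) :=
  Subtype.ext ((S.pull_congr hX hX rfl (S.ft_pull hX f).symm _ _ (by simp)).trans
    (toOb₁_map_val hX _).symm)

theorem diag_boundary {X : D} (hX : 0 < S.l X) :
    (S.diag X hX).boundary = (S.toOb₁ X hX).map (S.p X) :=
  Subtype.ext ((S.pull_congr hX hX rfl rfl _ _ (by simp)).trans (toOb₁_map_val hX _).symm)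

theorem diag_map_cod {X Z : D} (hX : 0 < S.l X) (m : Z ⟶ X) {a : Z ⟶ S.ft X}
    (ha : m ≫ S.p X = a) : ((S.diag X hX).map m).cod = S.pull hX a :=
  (S.pull_comp hX m (𝟙 X ≫ S.p X)).symm.trans
    (S.pull_congr hX hX rfl rfl _ _ (by simp [ha]))

/-- Recovers `m` from the pulled back diagonal: `q(m ≫ p_X, X)` factors through `q(p_X, X)`, which
cancels `s_{id_X}`. -/
theorem diag_map_sec {X Z : D} (hX : 0 < S.l X) (m : Z ⟶ X) {a : Z ⟶ S.ft X}
    (ha : m ≫ S.p X = a) :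
    ((S.diag X hX).map m).sec ≫ eqToHom (diag_map_cod hX m ha) ≫ S.q hX a = m := by
  have h₁ := (S.diag X hX).mapSec_q m
  have h₂ := S.q_comp hX m (𝟙 X ≫ S.p X)
  rw [S.q_congr hX hX rfl rfl (m ≫ 𝟙 X ≫ S.p X) a (by simp [ha])] at h₂
  have h₃ : S.q hX a = eqToHom (diag_map_cod hX m ha).symm ≫
      S.q (S.diag X hX).l_pos (m ≫ eqToHom (S.diag X hX).ft_cod.symm) ≫
        S.q hX (𝟙 X ≫ S.p X) := by
    rw [← cancel_epi (eqToHom (S.pull_congr hX hX rfl rfl (m ≫ 𝟙 X ≫ S.p X) a (by simp [ha])))]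
    simp only [eqToHom_refl, Category.comp_id] at h₂
    rw [eqToHom_trans_assoc]
    exact h₂
  rw [h₃, eqToHom_trans_assoc, eqToHom_refl, Category.id_comp]
  refine (Category.assoc _ _ _).symm.trans ((congrArg (· ≫ S.q hX (𝟙 X ≫ S.p X)) h₁).trans ?_)
  exact (Category.assoc _ _ _).trans
    ((congrArg (m ≫ ·) (S.s_q hX (𝟙 X))).trans (Category.comp_id m))

theorem diag_map_eq {X Z : D} (hX : 0 < S.l X) (m : Z ⟶ X) {a : Z ⟶ S.ft X}
    (ha : m ≫ S.p X = a) {t : S.Obt₁ Z} (e : t.cod = S.pull hX a)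
    (h : t.sec ≫ eqToHom e ≫ S.q hX a = m) : (S.diag X hX).map m = t :=
  Obt₁.ext_of_q hX rfl (diag_map_cod hX m ha) e rfl rfl ((diag_map_sec hX m ha).trans h.symm)

/-- The uniqueness half of the pullback property. Agreement over `ft X` is needed because `m` is
recovered through `q(a, X)`, and the section alone does not determine `a`. -/
theorem diag_map_injective {X Z : D} (hX : 0 < S.l X) {m m' : Z ⟶ X}
    (hp : m ≫ S.p X = m' ≫ S.p X) (h : (S.diag X hX).map m = (S.diag X hX).map m') : m = m' := by
  -- Equal sections have codomains that are only propositionally equal, so the equation is stated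
  -- for variables and then substituted.
  have key : ∀ {t t' : S.Obt₁ Z} (_ : t = t') {a : Z ⟶ S.ft X} (e : t.cod = S.pull hX a)
      (e' : t'.cod = S.pull hX a),
      t.sec ≫ eqToHom e ≫ S.q hX a = t'.sec ≫ eqToHom e' ≫ S.q hX a := by
    rintro t _ rfl a e e'
    rfl
  exact (diag_map_sec hX m hp).symm.trans ((key h _ _).trans (diag_map_sec hX m' rfl))

/-- The source of `Q_pull`: composed with `q(f, X)`, the identity `s_{id} ≫ q(p, f^*X) = id` shows
that the diagonal of `f^*X` represents the morphism `q(f, X)`. -/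
theorem diag_map_q {X Y : D} (hX : 0 < S.l X) (f : Y ⟶ S.ft X) :
    (S.diag X hX).map (S.q hX f) = S.diag (S.pull hX f) (S.l_pull_pos hX f) := by
  have h := S.q_comp hX (S.p (S.pull hX f) ≫ eqToHom (S.ft_pull hX f)) f
  have e : S.pull (S.l_pull_pos hX f) (𝟙 _ ≫ S.p (S.pull hX f)) = S.pull (S.l_pull_pos hX f)
      ((S.p (S.pull hX f) ≫ eqToHom (S.ft_pull hX f)) ≫ eqToHom (S.ft_pull hX f).symm) :=
    S.pull_congr _ _ rfl rfl _ _ (by simp)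
  refine diag_map_eq hX _ (a := (S.p (S.pull hX f) ≫ eqToHom (S.ft_pull hX f)) ≫ f)
    (by simp [S.comm]) (e.trans (S.pull_comp hX _ f).symm) ?_
  have h' := S.s_q (S.l_pull_pos hX f) (𝟙 _)
  rw [S.q_congr (S.l_pull_pos hX f) (S.l_pull_pos hX f) rfl rfl (𝟙 _ ≫ S.p (S.pull hX f))
    ((S.p (S.pull hX f) ≫ eqToHom (S.ft_pull hX f)) ≫ eqToHom (S.ft_pull hX f).symm)
    (by simp)] at h'
  rw [h]
  dsimp only [diag]
  rw [eqToHom_trans_assoc]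
  simpa using congrArg (· ≫ S.q hX f) h'

/-- The existence half of the pullback property, with `m = t ≫ q(a, X)`. -/
theorem exists_diag_map_eq {X Z : D} (hX : 0 < S.l X) (a : Z ⟶ S.ft X) (t : S.Obt₁ Z)
    (h : (S.toOb₁ X hX).map a = t.boundary) :
    ∃ m : Z ⟶ X, m ≫ S.p X = a ∧ (S.diag X hX).map m = t := by
  have e : t.cod = S.pull hX a := (congrArg Subtype.val h).symm.trans (toOb₁_map_val hX a)
  have ha : (t.sec ≫ eqToHom e ≫ S.q hX a) ≫ S.p X = a := by
    rw [Category.assoc, Category.assoc, S.comm, S.p_congr e.symm]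
    simp [reassoc_of% t.sec_p]
  exact ⟨_, ha, diag_map_eq hX _ ha e rfl⟩

variable (S) in
/-- The values of the presheaf of sets `Ob_1`. -/
noncomputable def ob₁Equiv [Small.{w} D] (X : D) : S.Ob₁ X ≃ (Ob₁Presheaf.{w} S).obj (op X) :=
  equivShrink (S.Ob₁ X)

variable (S) in
/-- The values of the presheaf of sets `Obt_1`. -/
noncomputable def obt₁Equiv [Small.{w} D] [LocallySmall.{w} D] (X : D) :
    S.Obt₁ X ≃ (Obt₁Presheaf.{w} S).obj (op X) :=
  equivShrink (S.Obt₁ X)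

theorem Ob₁Presheaf_map [Small.{w} D] {X Y : D} (f : Y ⟶ X) (y : S.Ob₁ X) :
    (Ob₁Presheaf.{w} S).map f.op (S.ob₁Equiv X y) = S.ob₁Equiv Y (y.map f) :=
  congrArg (fun z => S.ob₁Equiv Y (Ob₁.map f z)) (Equiv.symm_apply_apply _ _)

theorem Obt₁Presheaf_map [Small.{w} D] [LocallySmall.{w} D] {X Y : D} (f : Y ⟶ X)
    (t : S.Obt₁ X) :
    (Obt₁Presheaf.{w} S).map f.op (S.obt₁Equiv X t) = S.obt₁Equiv Y (t.map f) :=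
  congrArg (fun z => S.obt₁Equiv Y (Obt₁.map f z)) (Equiv.symm_apply_apply _ _)

theorem boundary_app [Small.{w} D] [LocallySmall.{w} D] {X : D} (t : S.Obt₁ X) :
    (boundary.{w} S).app (op X) (S.obt₁Equiv X t) =
      S.ob₁Equiv X t.boundary :=
  congrArg (fun z => S.ob₁Equiv X (Obt₁.boundary z)) (Equiv.symm_apply_apply _ _)

end Diagonal

end CSystem

/-! ### Elements of a left Kan extension along a functor with filtered slices -/

section Lan

variable {D : Type u₁} [Category.{v} D] {C : Type u} [Category.{v} C] (i : D ⥤ C)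

/-- `α` and `β` become parallel arrows in the filtered slice category, and `γ` is their coequalizing
arrow read in `D`. -/
theorem exists_comp_eq_of_comp_map_eq {c : C} [IsFiltered (CostructuredArrow i.op (op c))]
    {x z : D} {k : c ⟶ i.obj z} {α β : z ⟶ x} (h : k ≫ i.map α = k ≫ i.map β) :
    ∃ (z' : D) (k' : c ⟶ i.obj z') (γ : z' ⟶ z), k' ≫ i.map γ = k ∧ γ ≫ α = γ ≫ β := by
  let jx := CostructuredArrow.mk (S := i.op) (Y := op x) (k ≫ i.map α).op
  let jz := CostructuredArrow.mk (S := i.op) (Y := op z) k.op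
  let a : jx ⟶ jz := CostructuredArrow.homMk α.op rfl
  let b : jx ⟶ jz := CostructuredArrow.homMk β.op (congrArg Quiver.Hom.op h.symm)
  have e := congrArg CommaMorphism.left (IsFiltered.coeq_condition a b)
  exact ⟨(IsFiltered.coeq a b).left.unop, (IsFiltered.coeq a b).hom.unop,
    (IsFiltered.coeqHom a b).left.unop,
    congrArg Quiver.Hom.unop (CostructuredArrow.w (IsFiltered.coeqHom a b)),
    congrArg Quiver.Hom.unop e⟩

variable [Small.{v} D] (P : Dᵒᵖ ⥤ Type v)

/-- The element of the left Kan extension of a presheaf that is represented by an element of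
`P(x)` and a morphism `c ⟶ i(x)`. -/
noncomputable def lanMk {c : C} {x : D} (g : c ⟶ i.obj x) (a : P.obj (op x)) :
    (i.op.lan.obj P).obj (op c) :=
  (i.op.lan.obj P).map g.op ((i.op.lanUnit.app P).app (op x) a)

variable {P}

theorem lan_obj_map_lanMk {c d : C} {x : D} (h : d ⟶ c) (g : c ⟶ i.obj x) (a : P.obj (op x)) :
    (i.op.lan.obj P).map h.op (lanMk i P g a) = lanMk i P (h ≫ g) a := by
  simp [lanMk]

/-- The relation that generates the identifications in the colimit. -/
theorem lanMk_comp_map {c : C} {x y : D} (g : c ⟶ i.obj x) (f : x ⟶ y) (a : P.obj (op y)) :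
    lanMk i P (g ≫ i.map f) a = lanMk i P g (P.map f.op a) := by
  have h := NatTrans.naturality_apply (i.op.lanUnit.app P) f.op a
  refine Eq.trans ?_ (congrArg ((i.op.lan.obj P).map g.op) h.symm)
  simp [lanMk]

theorem lan_map_app_lanMk {P' : Dᵒᵖ ⥤ Type v} (φ : P ⟶ P') {c : C} {x : D} (g : c ⟶ i.obj x)
    (a : P.obj (op x)) :
    (i.op.lan.map φ).app (op c) (lanMk i P g a) = lanMk i P' g (φ.app (op x) a) := by
  have h := ConcreteCategory.congr_hom (NatTrans.congr_app (i.op.lanUnit.naturality φ) (op x)) a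
  have h' := NatTrans.naturality_apply (i.op.lan.map φ) g.op ((i.op.lanUnit.app P).app (op x) a)
  refine h'.trans ?_
  exact congrArg ((i.op.lan.obj P').map g.op) h.symm

/-- The values of the left Kan extension are pointwise colimits. -/
noncomputable def isColimitLan (P : Dᵒᵖ ⥤ Type v) (c : C) :
    IsColimit ((Functor.LeftExtension.mk _ (i.op.lanUnit.app P)).coconeAt (op c)) :=
  Functor.isPointwiseLeftKanExtensionOfIsLeftKanExtension (i.op.lan.obj P)
    (i.op.lanUnit.app P) (op c)

theorem exists_lanMk {c : C} (z : (i.op.lan.obj P).obj (op c)) :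
    ∃ (x : D) (g : c ⟶ i.obj x) (a : P.obj (op x)), lanMk i P g a = z := by
  obtain ⟨j, a, h⟩ := Types.jointly_surjective_of_isColimit (isColimitLan i P c) z
  exact ⟨j.left.unop, j.hom.unop, a, h⟩

/-- In a filtered colimit of sets, two representatives of one element already agree at a common
later stage; in `D` this stage is an object `z` mapping to both `x` and `y`. -/
theorem exists_of_lanMk_eq {c : C} [IsFiltered (CostructuredArrow i.op (op c))] {x y : D}
    {g : c ⟶ i.obj x} {h : c ⟶ i.obj y} {a : P.obj (op x)} {b : P.obj (op y)}
    (e : lanMk i P g a = lanMk i P h b) :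
    ∃ (z : D) (k : c ⟶ i.obj z) (α : z ⟶ x) (β : z ⟶ y), k ≫ i.map α = g ∧ k ≫ i.map β = h ∧
      P.map α.op a = P.map β.op b := by
  obtain ⟨j, α, β, h'⟩ := (Types.FilteredColimit.isColimit_eq_iff _ (isColimitLan i P c)
    (i := CostructuredArrow.mk (S := i.op) (Y := op x) g.op)
    (j := CostructuredArrow.mk (S := i.op) (Y := op y) h.op) (xi := a) (xj := b)).1 e
  exact ⟨j.left.unop, j.hom.unop, α.left.unop, β.left.unop,
    congrArg Quiver.Hom.unop (CostructuredArrow.w α),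
    congrArg Quiver.Hom.unop (CostructuredArrow.w β), h'⟩

end Lan

/-! ### The model of a C-system in the universe `Lan_i ∂` -/

namespace CSystem

variable {D : Type u₁} [Category.{v} D] [Small.{v} D] (S : CSystem D) {C : Type u}
  [Category.{v} C] (i : D ⥤ C)

/-- The morphism `Y(i(ft(X))) ⟶ Lan_i Ob_1` given by `X`. -/
noncomputable def lanF (X : D) (hX : 0 < S.l X) :
    yoneda.obj (i.obj (S.ft X)) ⟶ i.op.lan.obj (Ob₁Presheaf.{v} S) :=
  yonedaEquiv.symm (lanMk i _ (𝟙 _) (S.ob₁Equiv (S.ft X) (S.toOb₁ X hX)))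

/-- The morphism `Y(i(X)) ⟶ Lan_i Obt_1` given by the diagonal section of `X`. -/
noncomputable def lanQ (X : D) (hX : 0 < S.l X) :
    yoneda.obj (i.obj X) ⟶ i.op.lan.obj (Obt₁Presheaf.{v} S) :=
  yonedaEquiv.symm (lanMk i _ (𝟙 _) (S.obt₁Equiv X (S.diag X hX)))

variable {S}

theorem lanF_app {X : D} (hX : 0 < S.l X) {c : C} (g : c ⟶ i.obj (S.ft X)) :
    (S.lanF i X hX).app (op c) g =
      lanMk i _ g (S.ob₁Equiv (S.ft X) (S.toOb₁ X hX)) := by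
  refine (yonedaEquiv_symm_app_apply _ (op c) g).trans ?_
  rw [lan_obj_map_lanMk, Category.comp_id]

theorem lanQ_app {X : D} (hX : 0 < S.l X) {c : C} (g : c ⟶ i.obj X) :
    (S.lanQ i X hX).app (op c) g = lanMk i _ g (S.obt₁Equiv X (S.diag X hX)) := by
  refine (yonedaEquiv_symm_app_apply _ (op c) g).trans ?_
  rw [lan_obj_map_lanMk, Category.comp_id]

/-- Pullbacks of presheaves are pointwise, and at each `c` representatives are brought to a common
stage, where the pullback property inside the C-system applies. -/
theorem lan_isPullback (hfil : ∀ c : C, IsFiltered (CostructuredArrow i.op (op c))) {X : D}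
    (hX : 0 < S.l X) :
    IsPullback (S.lanQ i X hX) (yoneda.map (i.map (S.p X)))
      (i.op.lan.map (boundary.{v} S)) (S.lanF i X hX) := by
  refine IsPullback.of_forall_isPullback_app fun c => ?_
  obtain ⟨c⟩ := c
  have := hfil c
  rw [Types.isPullback_iff]
  refine ⟨?_, ?_, ?_⟩
  · refine ConcreteCategory.hom_ext _ _ fun (g : c ⟶ i.obj X) => ?_
    change (i.op.lan.map (boundary.{v} S)).app (op c) ((S.lanQ i X hX).app (op c) g) =
      (S.lanF i X hX).app (op c) (g ≫ i.map (S.p X))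
    rw [lanQ_app, lanF_app, lan_map_app_lanMk, boundary_app, lanMk_comp_map, Ob₁Presheaf_map,
      diag_boundary]
  · rintro (g : c ⟶ i.obj X) (g' : c ⟶ i.obj X) ⟨h₁, h₂⟩
    replace h₁ : (S.lanQ i X hX).app (op c) g = (S.lanQ i X hX).app (op c) g' := h₁
    replace h₂ : g ≫ i.map (S.p X) = g' ≫ i.map (S.p X) := h₂
    rw [lanQ_app, lanQ_app] at h₁
    obtain ⟨z, k, α, β, rfl, rfl, h⟩ := exists_of_lanMk_eq i h₁
    rw [Obt₁Presheaf_map, Obt₁Presheaf_map, EmbeddingLike.apply_eq_iff_eq] at h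
    -- At stage `z` the pulled back diagonals agree, but the projections to `ft X` agree only after
    -- composing with `k`; one further refinement makes them agree in `D`.
    obtain ⟨z', k', γ, rfl, h'⟩ := exists_comp_eq_of_comp_map_eq i
      (α := α ≫ S.p X) (β := β ≫ S.p X) (k := k) (by simpa using h₂)
    have : γ ≫ α = γ ≫ β := diag_map_injective hX (by simpa using h')
      (by rw [Obt₁.map_comp, Obt₁.map_comp, h])
    rw [Category.assoc, Category.assoc, ← i.map_comp, ← i.map_comp, this]
  · intro t (g : c ⟶ i.obj (S.ft X)) h
    replace h : (i.op.lan.map (boundary.{v} S)).app (op c) t = (S.lanF i X hX).app (op c) g := h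
    obtain ⟨y, g', t, rfl⟩ := exists_lanMk i t
    obtain ⟨t, rfl⟩ := (S.obt₁Equiv y).surjective t
    rw [lanF_app, lan_map_app_lanMk, boundary_app] at h
    obtain ⟨z, k, β, α, rfl, rfl, hz⟩ := exists_of_lanMk_eq i h
    rw [Ob₁Presheaf_map, Ob₁Presheaf_map, EmbeddingLike.apply_eq_iff_eq] at hz
    -- At the common stage the section lies over `α^*X`, so it yields a morphism `m : z ⟶ X`, and `k
    -- ≫ i.map m` is the required element.
    obtain ⟨m, hm, ht⟩ := exists_diag_map_eq hX α (t.map β) hz.symm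
    refine ⟨(k ≫ i.map m : c ⟶ i.obj X), ?_, ?_⟩
    · refine (lanQ_app i hX (k ≫ i.map m)).trans ?_
      rw [lanMk_comp_map, lanMk_comp_map, Obt₁Presheaf_map, Obt₁Presheaf_map, ht]
    · change (k ≫ i.map m) ≫ i.map (S.p X) = k ≫ i.map α
      rw [Category.assoc, ← i.map_comp, hm]

variable (S)

/-- The inclusion of a small C-system into a category, followed by the Yoneda embedding, is a model
in the universe `Lan_i ∂`. -/
noncomputable def lanModel (hfil : ∀ c : C, IsFiltered (CostructuredArrow i.op (op c)))
    (hpt : IsTerminal (i.obj S.pt)) :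
    S.UniverseModel (presheafUniverse (i.op.lan.map (boundary.{v} S))) (i ⋙ yoneda) where
  F := S.lanF i
  Q := S.lanQ i
  isPullback _ hX := lan_isPullback i hfil hX
  F_pull {X Y} hX f := by
    refine NatTrans.ext (funext fun ⟨c⟩ => ConcreteCategory.hom_ext _ _ fun
      (g : c ⟶ i.obj (S.ft (S.pull hX f))) => ?_)
    change (S.lanF i _ _).app (op c) g =
      (S.lanF i X hX).app (op c) (g ≫ i.map (eqToHom (S.ft_pull hX f) ≫ f))
    rw [lanF_app, lanF_app, lanMk_comp_map, Ob₁Presheaf_map, toOb₁_pull]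
  Q_pull {X Y} hX f := by
    refine NatTrans.ext (funext fun ⟨c⟩ => ConcreteCategory.hom_ext _ _ fun
      (g : c ⟶ i.obj (S.pull hX f)) => ?_)
    change (S.lanQ i _ _).app (op c) g = (S.lanQ i X hX).app (op c) (g ≫ i.map (S.q hX f))
    rw [lanQ_app, lanQ_app, lanMk_comp_map, Obt₁Presheaf_map, diag_map_q]
  isTerminalPt := hpt.isTerminalObj yoneda _

end CSystem

/-! ### The homomorphism from the original C-system -/

theorem mainTheorem1 {CC : Type u₁} [Category.{v₁} CC] [Small.{v} CC] (S : CSystem CC)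
    {C : Type u} [Category.{v} C] (M : CC ⥤ C) (hM : InjectiveOnMorphisms M)
    (hpt : Nonempty (IsTerminal (M.obj S.pt)))
    (hfil : ∀ c : C, IsFiltered (CostructuredArrow (ImageCat.incl M hM).op (op c))) :
    ∃ 𝒰 : UniverseCategory (Cᵒᵖ ⥤ Type v), 𝒰 = presheafUniverse (lanBoundary S M hM) ∧
      ∃ M' : CSystemHom S 𝒰.cSystem, Nonempty (M'.functor ⋙ 𝒰.int ≅ M ⋙ yoneda) := by
  -- The distinguished object of the image is by definition `M(pt)`, so its finality in `C` is the
  -- given one.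
  let R := (S.image M hM).lanModel (ImageCat.incl M hM) hfil hpt.some
  -- The restriction of `M` followed by the inclusion is `M` definitionally, so whiskering the
  -- comparison isomorphism of the model already has the required type.
  exact ⟨_, rfl, (S.imageHom M hM).comp R.hom,
    ⟨Functor.isoWhiskerLeft (ImageCat.restr M hM) R.functorCompInt⟩⟩
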